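/- Let $d\ge 2$, $C\ge 1$ and $\theta_1,\dots,\theta_d\in[1/C,C]$, and put $Q(\mathbf n)=\theta_1n_1^2+\cdots+\theta_dn_d^2$ for $\mathbf n\in\mathbb Z^d$. On $\mathbb T^d=(\mathbb R/\mathbb Z)^d$ define, for $f\in L^2(\mathbb T^d)$, $$e^{-it\Delta}f(\mathbf x)=\sum_{\mathbf n\in\mathbb Z^d}\widehat f(\mathbf n)\,e^{2\pi i(\mathbf n\cdot\mathbf x+Q(\mathbf n)t)} .$$ Let $I\subset\mathbb R$ be a compact interval of positive length, let $N$ be a real number, and let $f\in L^2(\mathbb T^d)$ satisfy $\operatorname{supp}\widehat f\subset[-N,N]^d$. Exponents $p$ range over $[4,\infty]$, with $2/p=0$ if $p=\infty$. (i) If $d\ge3$, $p\ge4$, $p>\frac{16}{d}$ and $N\ge1$, then $$\|e^{-it\Delta}f\|_{L^p_tL^4_{\mathbf x}(I\times\mathbb T^d)}\le K\,N^{\frac d4-\frac2p}\,\|f\|_{L^2(\mathbb T^d)} .$$ (ii) If $d=2$ and $p\ge8$, or $(d,p)=(3,\frac{16}{3})$, or $(d,p)=(4,4)$, and if $N\ge2$,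 then $$\|e^{-it\Delta}f\|_{L^p_tL^4_{\mathbf x}(I\times\mathbb T^d)}\le K\,N^{\frac d4-\frac2p}(\log N)^{\frac2q}\,\|f\|_{L^2(\mathbb T^d)},$$ where $q=8$ if $d=2$ and $q=p$ if $d=3,4$. Here $K$ depends only on $d$, $p$, $C$ and the length of $I$; in particular it does not depend on $f$, on $N$, on the position of $I$, or on $\theta_1,\dots,\theta_d$ other than through $C$. -/

import Mathlib

open MeasureTheory UnitAddTorus
open scoped ENNReal

/- `ℝ / ℤ` carries its normalised Haar (Lebesgue) measure, of total mass one; the torus `𝕋ᵈ`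
(`UnitAddTorus (Fin d)`) carries the product measure. This is Mathlib's own instance. -/
attribute [local instance] instMeasureSpaceUnitAddCircle

/-- The space `L²(𝕋ᵈ)` of complex-valued functions on `𝕋ᵈ = (ℝ / ℤ)ᵈ`. -/
abbrev L2Torus (d : ℕ) : Type := Lp ℂ 2 (volume : Measure (UnitAddTorus (Fin d)))

/-- The quadratic form `Q(n) = θ₁ n₁² + ⋯ + θ_d n_d²`. -/
def quadForm {d : ℕ} (θ : Fin d → ℝ) (n : Fin d → ℤ) : ℝ := ∑ j, θ j * (n j : ℝ) ^ 2

/-- The linear Schrödinger evolution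
`e^{-itΔ} f (x) = ∑ₙ f̂(n) e^{2πi (n·x + Q(n) t)}`, the series converging in `L²(𝕋ᵈ)`. -/
noncomputable def schrodinger {d : ℕ} (θ : Fin d → ℝ) (t : ℝ) (f : L2Torus d) : L2Torus d :=
  ∑' n : Fin d → ℤ,
    (mFourierCoeff f n * Complex.exp (2 * Real.pi * Complex.I * (quadForm θ n * t : ℝ))) •
      mFourierLp 2 n

/-- The series defining the evolution converges in `L²` for every `f` in `L²`. -/
theorem hasSum_schrodinger {d : ℕ} (θ : Fin d → ℝ) (t : ℝ) (f : L2Torus d) :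
    HasSum (fun n : Fin d → ℤ =>
      (mFourierCoeff f n * Complex.exp (2 * Real.pi * Complex.I * (quadForm θ n * t : ℝ))) •
        mFourierLp 2 n) (schrodinger θ t f) := by
  apply Summable.hasSum
  have hmem : Memℓp (fun n : Fin d → ℤ => mFourierCoeff f n *
      Complex.exp (2 * Real.pi * Complex.I * (quadForm θ n * t : ℝ))) 2 := by
    refine (lp.memℓp (mFourierBasis.repr f)).mono' fun n => ?_
    rw [mFourierBasis_repr, norm_mul,
      show (2 * Real.pi * Complex.I * (quadForm θ n * t : ℝ) : ℂ)
        = ((2 * Real.pi * (quadForm θ n * t) : ℝ) : ℂ) * Complex.I by push_cast; ring,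
      Complex.norm_exp_ofReal_mul_I, mul_one]
  have := (mFourierBasis (d := Fin d)).hasSum_repr_symm ⟨_, hmem⟩
  simpa using this.summable

/-- `supp f̂ ⊆ [-N, N]ᵈ`. -/
def FourierSupportedIn {d : ℕ} (f : L2Torus d) (N : ℝ) : Prop :=
  ∀ n : Fin d → ℤ, mFourierCoeff f n ≠ 0 → ∀ j, |(n j : ℝ)| ≤ N

/-- The mixed norm `‖e^{-itΔ} f‖_{L^p_t L^4_x(I × 𝕋ᵈ)}`, for `1 ≤ p ≤ ∞`
(an essential supremum in time if `p = ∞`). -/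
noncomputable def evolutionNorm {d : ℕ} (θ : Fin d → ℝ) (p : ℝ≥0∞) (I : Set ℝ) (f : L2Torus d) :
    ℝ≥0∞ :=
  eLpNorm (fun t : ℝ => eLpNorm (schrodinger θ t f) 4 volume) p (volume.restrict I)

/-- The estimate `‖e^{-itΔ} f‖_{L^p_t L^4_x(I × 𝕋ᵈ)} ≲ κ(N) ‖f‖_{L²}` for all `N ≥ N₀`, all
`f ∈ L²(𝕋ᵈ)` with `supp f̂ ⊆ [-N, N]ᵈ`, all compact intervals `I` and all
`θ ∈ [1/C, C]ᵈ`; the implicit constant depends only on `d`, `p`, `C` and the length of `I`. -/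
def StrichartzL4 (d : ℕ) (p : ℝ≥0∞) (N₀ : ℝ) (κ : ℝ → ℝ) : Prop :=
  ∀ C : ℝ, 1 ≤ C → ∀ L : ℝ, 0 < L → ∃ K : ℝ, 0 < K ∧
    ∀ θ : Fin d → ℝ, (∀ j, 1 / C ≤ θ j ∧ θ j ≤ C) →
    ∀ a b : ℝ, b - a = L →
    ∀ N : ℝ, N₀ ≤ N →
    ∀ f : L2Torus d, FourierSupportedIn f N →
      evolutionNorm θ p (Set.Icc a b) f ≤ ENNReal.ofReal (K * κ N * ‖f‖)

/-! The exponent 4 in space lets the problem be squared. Write u for the evolution. Then ‖u(t)‖₄⁴ =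
‖u(t)²‖₂² is, by Parseval, a sum over m of squared Fourier coefficients of u(t)². For n + n' = m the
parallelogram law gives Q(n) + Q(n') = Q(m)/2 + Q(n - n')/2, so up to a unimodular factor the m-th
coefficient is an exponential sum in t alone, with frequencies Q(k)/2 and |k_j| ≤ 2N
(`norm_sum_pairFiber_eq`). With ρ = p/4 ≥ 1, Minkowski in L^ρ over m leaves an L^{2ρ} bound in time
for each of these sums.

That bound is a TT* argument (`lintegral_expSum_rpow_le`): duality, Cauchy–Schwarz and Young's
inequality reduce it to the L^ρ norm of a kernel with the same frequencies and any nonnegative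
weights that are at least 1 on the support of the coefficients. Gaussian weights make the kernel a
product of d one-dimensional Weyl sums, and Hölder reduces it to their L^s norm with s = dρ = dp/4.
Each θ_j enters only through a dilation of time, so no arithmetic property of θ is needed.

The Gaussian Weyl sum is a Jacobi theta function. Its modular transform near a/q, with the Gauss sum
bound, gives |W(t)| ≲ (q(R⁻² + |t - a/q|))^{-1/2} at some fraction with q ≤ R for every t, without
ε-loss. Integrating the s-th power over all fractions yields R^{s-2} ∑_{q ≤ R} q^{1-s/2}: bounded by
a multiple of R^{s-2} if s > 4, that is p > 16/d, and with one logarithm if s = 4. Taking the power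
1/p turns R^{s-2} into N^{d/4-2/p}. The case p = ∞ is Cauchy–Schwarz on each coefficient. -/

/-! ### Complete quadratic Gauss sums -/

/-- At most two residues modulo `q` are annihilated by `2`. -/
lemma card_two_mul_eq_zero_le (q : ℕ) [NeZero q] :
    (Finset.univ.filter fun h : ZMod q => 2 * h = 0).card ≤ 2 := by
  have hsub : (Finset.univ.filter fun h : ZMod q => 2 * h = 0) ⊆ {0, ((q / 2 : ℕ) : ZMod q)} := by
    intro h hh
    simp only [Finset.mem_filter, Finset.mem_univ, true_and] at hh
    have h1 : ((2 * h.val : ℕ) : ZMod q) = 0 := by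
      push_cast; rw [ZMod.natCast_zmod_val]; exact hh
    rw [ZMod.natCast_eq_zero_iff] at h1
    have h2 := ZMod.val_lt h
    obtain ⟨k, hk⟩ := h1
    have hk2 : k < 2 := by
      by_contra! hcon
      have : q * 2 ≤ q * k := Nat.mul_le_mul_left q hcon
      omega
    simp only [Finset.mem_insert, Finset.mem_singleton]
    interval_cases k
    · left
      rw [← ZMod.val_eq_zero]; omega
    · right
      have : q / 2 = h.val := by omega
      rw [this, ZMod.natCast_zmod_val]
  exact (Finset.card_le_card hsub).trans Finset.card_le_two

/-- The bound `|S|² ≤ 2q` for quadratic Gauss sums modulo `q` with a unit leading coefficient. -/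
lemma normSq_quadratic_gaussSum_le (q : ℕ) [NeZero q] {a : ZMod q} (ha : IsUnit a) (m : ZMod q) :
    ‖∑ r : ZMod q, ZMod.stdAddChar (a * r ^ 2 + m * r)‖ ^ 2 ≤ 2 * q := by
  set χ : AddChar (ZMod q) ℂ := ZMod.stdAddChar with hχ
  have hnorm : ∀ x, ‖χ x‖ = 1 := fun x => by
    rw [hχ, ZMod.stdAddChar_apply, Circle.norm_coe]
  have hconj : ∀ x, starRingEnd ℂ (χ x) = χ (-x) := fun x => by
    rw [AddChar.map_neg_eq_inv, Complex.inv_eq_conj (hnorm x)]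
  have hprim : χ.IsPrimitive := ZMod.isPrimitive_stdAddChar q
  set S := ∑ r : ZMod q, χ (a * r ^ 2 + m * r) with hS
  -- Weyl differencing: after r = s + h the phase is linear in s, so orthogonality kills every h
  -- with 2ah ≠ 0.
  have hexp : S * starRingEnd ℂ S = ∑ h : ZMod q, χ (a * h ^ 2 + m * h) *
      (if 2 * a * h = 0 then (Fintype.card (ZMod q) : ℂ) else 0) := by
    have h1 : S * starRingEnd ℂ S = ∑ s : ZMod q, ∑ h : ZMod q,
        χ (a * h ^ 2 + m * h) * χ (s * (2 * a * h)) := by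
      rw [mul_comm, hS, map_sum, Finset.sum_mul]
      refine Finset.sum_congr rfl fun s _ => ?_
      rw [Finset.mul_sum, ← Equiv.sum_comp (Equiv.addRight s)]
      refine Finset.sum_congr rfl fun h _ => ?_
      rw [hconj, ← AddChar.map_add_eq_mul, ← AddChar.map_add_eq_mul]
      congr 1
      simp only [Equiv.coe_addRight]
      ring
    rw [h1, Finset.sum_comm]
    refine Finset.sum_congr rfl fun h _ => ?_
    rw [← Finset.mul_sum, AddChar.sum_mulShift _ hprim]
    split_ifs <;> simp
  have hsq : ‖S‖ ^ 2 = ‖S * starRingEnd ℂ S‖ := by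
    rw [norm_mul, RCLike.norm_conj, sq]
  rw [hsq, hexp]
  calc _ ≤ ∑ h : ZMod q, (if 2 * h = 0 then (q : ℝ) else 0) := by
        refine (norm_sum_le _ _).trans (Finset.sum_le_sum fun h _ => ?_)
        rw [norm_mul, hnorm, one_mul]
        have : (2 * a * h = 0) ↔ (2 * h = 0) := by
          rw [show 2 * a * h = a * (2 * h) by ring, ha.mul_right_eq_zero]
        simp only [this, ZMod.card]
        split_ifs <;> simp
    _ ≤ 2 * q := by
        rw [← Finset.sum_filter, Finset.sum_const, nsmul_eq_mul]
        exact mul_le_mul_of_nonneg_right (by exact_mod_cast card_two_mul_eq_zero_le q)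
          (Nat.cast_nonneg q)

/-- The quadratic exponential sum `∑_{r < q} e((a r² + m r) / q)`. -/
noncomputable def quadraticGaussSum (q : ℕ) (a m : ℤ) : ℂ :=
  ∑ r : Fin q, Complex.exp (2 * Real.pi * Complex.I * ((a * (r : ℕ) ^ 2 + m * (r : ℕ)) / q))

lemma norm_quadraticGaussSum_le {q : ℕ} [NeZero q] {a : ℤ} (ha : IsCoprime a (q : ℤ)) (m : ℤ) :
    ‖quadraticGaussSum q a m‖ ≤ √(2 * q) := by
  apply Real.le_sqrt_of_sq_le
  have hu : IsUnit (a : ZMod q) := by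
    rwa [ZMod.coe_int_isUnit_iff_isCoprime, isCoprime_comm]
  convert normSq_quadratic_gaussSum_le q hu (m : ZMod q) using 3
  refine Fintype.sum_bijective (fun r : Fin q => ((r : ℕ) : ZMod q)) ?_ _ _ fun r => ?_
  · rw [Fintype.bijective_iff_injective_and_card]
    refine ⟨fun x y hxy => ?_, by simp [ZMod.card]⟩
    rw [ZMod.natCast_eq_natCast_iff', Nat.mod_eq_of_lt x.2, Nat.mod_eq_of_lt y.2] at hxy
    exact Fin.ext hxy
  · have := ZMod.stdAddChar_coe (N := q) (a * (r : ℕ) ^ 2 + m * (r : ℕ))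
    push_cast at this
    rw [this]
    congr 1
    ring

/-! ### The theta function near a rational point -/

/-- Splitting the theta series at a rational translate into residue classes. -/
lemma jacobiTheta₂_rational_translate (q : ℕ) [NeZero q] (a : ℤ) {τ : ℂ} (hτ : 0 < τ.im) :
    jacobiTheta₂ 0 (2 * a / q + τ) = ∑ r : Fin q,
      Complex.exp (2 * Real.pi * Complex.I * (a * (r : ℕ) ^ 2 / q) +
        Real.pi * Complex.I * (r : ℕ) ^ 2 * τ) * jacobiTheta₂ ((r : ℕ) * q * τ) (q ^ 2 * τ) := by
  have hq : (q : ℂ) ≠ 0 := Nat.cast_ne_zero.mpr (NeZero.ne q)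
  have hτ1 : 0 < (2 * (a : ℂ) / q + τ).im := by
    have : (2 * (a : ℂ) / q) = ((2 * a / q : ℝ) : ℂ) := by push_cast; rfl
    rw [this, Complex.add_im, Complex.ofReal_im, zero_add]
    exact hτ
  have hτ2 : 0 < ((q : ℂ) ^ 2 * τ).im := by
    have : ((q : ℂ) ^ 2) = ((q ^ 2 : ℝ) : ℂ) := by push_cast; rfl
    rw [this, Complex.im_ofReal_mul]
    have : (0 : ℝ) < q := Nat.cast_pos.mpr (NeZero.pos q)
    positivity
  have hterm : ∀ p : ℤ × Fin q,
      jacobiTheta₂_term ((Int.divModEquiv q).symm p) 0 (2 * a / q + τ) =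
      Complex.exp (2 * Real.pi * Complex.I * (a * (p.2 : ℕ) ^ 2 / q) +
        Real.pi * Complex.I * (p.2 : ℕ) ^ 2 * τ) *
        jacobiTheta₂_term p.1 ((p.2 : ℕ) * q * τ) (q ^ 2 * τ) := by
    rintro ⟨k, r⟩
    rw [Int.divModEquiv_symm_apply, jacobiTheta₂_term, jacobiTheta₂_term, ← Complex.exp_add,
      Complex.exp_eq_exp_iff_exists_int]
    -- For n = qk + r, the numbers an²/q and ar²/q differ by this integer, so the phases agree.
    refine ⟨a * (q * k ^ 2 + 2 * k * (r : ℕ)), ?_⟩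
    push_cast
    field_simp
    ring
  have hs := (Int.divModEquiv q).symm.hasSum_iff.mpr (hasSum_jacobiTheta₂_term 0 hτ1)
  have hs' := (Equiv.prodComm (Fin q) ℤ).hasSum_iff.mpr hs
  have hfib : ∀ r : Fin q, HasSum (fun k : ℤ =>
      (((fun n => jacobiTheta₂_term n 0 (2 * a / q + τ)) ∘ (Int.divModEquiv q).symm) ∘
        (Equiv.prodComm (Fin q) ℤ)) (r, k))
      (Complex.exp (2 * Real.pi * Complex.I * (a * (r : ℕ) ^ 2 / q) +
        Real.pi * Complex.I * (r : ℕ) ^ 2 * τ) *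
        jacobiTheta₂ ((r : ℕ) * q * τ) (q ^ 2 * τ)) := by
    intro r
    simp only [Function.comp_apply, Equiv.prodComm_apply, Prod.swap_prod_mk, hterm]
    exact (hasSum_jacobiTheta₂_term _ hτ2).mul_left _
  exact (hs'.prod_fiberwise hfib).unique (hasSum_fintype _)

/-- The modular transform of the theta series at a rational translate. -/
lemma jacobiTheta₂_rational_translate_eq (q : ℕ) [NeZero q] (a : ℤ) {τ : ℂ} (hτ : 0 < τ.im) :
    jacobiTheta₂ 0 (2 * a / q + τ) = 1 / (-Complex.I * (q ^ 2 * τ)) ^ (1 / 2 : ℂ) *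
      ∑' m : ℤ, quadraticGaussSum q a m * jacobiTheta₂_term m 0 (-1 / (q ^ 2 * τ)) := by
  have hq : (q : ℂ) ≠ 0 := Nat.cast_ne_zero.mpr (NeZero.ne q)
  have hτ0 : τ ≠ 0 := by rintro rfl; simp at hτ
  have hτ2 : 0 < ((q : ℂ) ^ 2 * τ).im := by
    have : ((q : ℂ) ^ 2) = ((q ^ 2 : ℝ) : ℂ) := by push_cast; rfl
    rw [this, Complex.im_ofReal_mul]
    have : (0 : ℝ) < q := Nat.cast_pos.mpr (NeZero.pos q)
    positivity
  have hτ3 : 0 < (-1 / ((q : ℂ) ^ 2 * τ)).im := by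
    rw [neg_div, Complex.neg_im, one_div, Complex.inv_im, neg_div, neg_neg]
    exact div_pos hτ2 (Complex.normSq_pos.mpr (by positivity))
  rw [jacobiTheta₂_rational_translate q a hτ]
  -- The argument r/q of the transformed theta series supplies the phase e(mr/q); summing over r
  -- completes the Gauss sum.
  have h1 : ∀ r : Fin q, HasSum (fun m : ℤ =>
      Complex.exp (2 * Real.pi * Complex.I * ((a * (r : ℕ) ^ 2 + m * (r : ℕ)) / q)) *
        jacobiTheta₂_term m 0 (-1 / (q ^ 2 * τ)))
      (Complex.exp (2 * Real.pi * Complex.I * (a * (r : ℕ) ^ 2 / q)) *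
        jacobiTheta₂ ((r : ℕ) / q) (-1 / (q ^ 2 * τ))) := by
    intro r
    have h0 := (hasSum_jacobiTheta₂_term ((r : ℕ) / q : ℂ) hτ3).mul_left
      (Complex.exp (2 * Real.pi * Complex.I * (a * (r : ℕ) ^ 2 / q)))
    refine h0.congr_fun fun m => ?_
    simp only [jacobiTheta₂_term]
    rw [← Complex.exp_add, ← Complex.exp_add]
    congr 1
    ring
  have h2 : HasSum (fun m : ℤ => quadraticGaussSum q a m *
      jacobiTheta₂_term m 0 (-1 / (q ^ 2 * τ)))
      (∑ r : Fin q, Complex.exp (2 * Real.pi * Complex.I * (a * (r : ℕ) ^ 2 / q)) *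
        jacobiTheta₂ ((r : ℕ) / q) (-1 / (q ^ 2 * τ))) := by
    simp only [quadraticGaussSum, Finset.sum_mul]
    exact hasSum_sum fun r _ => h1 r
  rw [h2.tsum_eq, Finset.mul_sum]
  refine Finset.sum_congr rfl fun r _ => ?_
  rw [jacobiTheta₂_functional_equation ((r : ℕ) * q * τ)]
  have e1 : ((r : ℕ) : ℂ) * q * τ / (q ^ 2 * τ) = (r : ℕ) / q := by field_simp
  -- The Gaussian factor of the functional equation cancels the exp(πi r² τ) left by the residue
  -- class.
  have e2 : -Real.pi * Complex.I * (((r : ℕ) : ℂ) * q * τ) ^ 2 / (q ^ 2 * τ)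
      = -(Real.pi * Complex.I * (r : ℕ) ^ 2 * τ) := by field_simp
  rw [e1, e2, Complex.exp_add, Complex.exp_neg]
  have := Complex.exp_ne_zero (Real.pi * Complex.I * (r : ℕ) ^ 2 * τ)
  field_simp

/-- The Gaussian-weighted quadratic Weyl sum `∑ₙ e^{-π n² / R²} e(n² t)`. -/
noncomputable def gaussWeylSum (R t : ℝ) : ℂ :=
  jacobiTheta₂ 0 (2 * t + Complex.I / R ^ 2)

/-- The contribution of the reduced fraction `a / q` to the size of `gaussWeylSum`. -/
lemma norm_gaussWeylSum_le_of_near {R t : ℝ} (hR : 1 ≤ R) {q : ℕ} [NeZero q] (hqR : q ≤ R) {a : ℤ}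
    (ha : IsCoprime a (q : ℤ)) (hβ : |t - a / q| ≤ 1 / (R * q)) :
    ‖gaussWeylSum R t‖ ≤ 2 * (∑' m : ℤ, Real.exp (-(Real.pi / 5) * m ^ 2)) /
      √(q * ((R ^ 2)⁻¹ + |t - a / q|)) := by
  have hR0 : 0 < R := by linarith
  have hq : (0 : ℝ) < q := Nat.cast_pos.mpr (NeZero.pos q)
  set β := t - a / q with hβdef
  set τ : ℂ := 2 * β + Complex.I / R ^ 2 with hτdef
  have hre : τ.re = 2 * β := by
    have : τ = ((2 * β : ℝ) : ℂ) + (((R ^ 2)⁻¹ : ℝ) : ℂ) * Complex.I := by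
      rw [hτdef]; push_cast; ring
    rw [this, Complex.add_re, Complex.ofReal_re, Complex.re_ofReal_mul]; simp
  have him : τ.im = (R ^ 2)⁻¹ := by
    have : τ = ((2 * β : ℝ) : ℂ) + (((R ^ 2)⁻¹ : ℝ) : ℂ) * Complex.I := by
      rw [hτdef]; push_cast; ring
    rw [this, Complex.add_im, Complex.ofReal_im, Complex.im_ofReal_mul]; simp
  have hτ : 0 < τ.im := by rw [him]; positivity
  have hW : gaussWeylSum R t = jacobiTheta₂ 0 (2 * a / q + τ) := by
    rw [gaussWeylSum, hτdef, hβdef]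
    congr 1
    push_cast
    ring
  have hD : ((R ^ 2)⁻¹ + |β|) / 2 ≤ ‖τ‖ := by
    have h1 := Complex.abs_re_le_norm τ
    have h2 := Complex.abs_im_le_norm τ
    rw [hre, abs_mul, abs_two] at h1
    rw [him, abs_of_nonneg (by positivity)] at h2
    linarith [abs_nonneg β]
  have hD0 : 0 < (R ^ 2)⁻¹ + |β| := by positivity
  have hτn : 0 < ‖τ‖ := by linarith
  -- The imaginary part is R⁻² / (q²(R⁻⁴ + 4β²)). Since q ≤ R and |β| ≤ 1/(Rq), the denominator is
  -- at most R⁻² + 4R⁻², whence 1/5: the transformed series converges uniformly in R, q and β.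
  have him2 : 1 / 5 ≤ (-1 / ((q : ℂ) ^ 2 * τ)).im := by
    have e1 : (-1 / ((q : ℂ) ^ 2 * τ)) = (((q : ℝ) ^ 2)⁻¹ : ℝ) * (-τ⁻¹) := by
      push_cast; rw [neg_div, one_div, mul_inv]; ring
    rw [e1, Complex.im_ofReal_mul, Complex.neg_im, Complex.inv_im, him, Complex.normSq_apply, hre,
      him, neg_div, neg_neg, ← div_eq_inv_mul, div_div, div_le_div_iff₀ (by norm_num)]
    · have hb : |β| * (R * q) ≤ 1 := by rwa [le_div_iff₀ (by positivity)] at hβ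
      have hb2 : β ^ 2 * (R * q) ^ 2 ≤ 1 := by
        rw [← sq_abs, ← mul_pow]
        exact pow_le_one₀ (by positivity) hb
      have hq2 : (q : ℝ) ^ 2 ≤ R ^ 2 := by gcongr
      have hb3 : β ^ 2 * q ^ 2 ≤ (R ^ 2)⁻¹ := by
        rw [← one_div, le_div_iff₀ (by positivity)]
        nlinarith
      have hb4 : (R ^ 2)⁻¹ * (R ^ 2)⁻¹ * q ^ 2 ≤ (R ^ 2)⁻¹ := by
        rw [mul_assoc]
        apply mul_le_of_le_one_right (by positivity)
        rw [inv_mul_le_iff₀ (by positivity)]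
        linarith
      nlinarith
    · have : 0 < (R ^ 2)⁻¹ * (R ^ 2)⁻¹ := by positivity
      have : 0 ≤ 2 * β * (2 * β) := mul_self_nonneg _
      positivity
  have hsum : Summable fun m : ℤ => Real.exp (-(Real.pi / 5) * m ^ 2) := by
    have := (summable_jacobiTheta₂_term_iff 0 (Complex.I / 5)).mpr (by simp)
    refine this.norm.congr fun m => ?_
    rw [norm_jacobiTheta₂_term]
    congr 1
    simp
    ring
  have hbound : ‖∑' m : ℤ, quadraticGaussSum q a m * jacobiTheta₂_term m 0 (-1 / (q ^ 2 * τ))‖ ≤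
      √(2 * q) * ∑' m : ℤ, Real.exp (-(Real.pi / 5) * m ^ 2) := by
    rw [← tsum_mul_left]
    refine tsum_of_norm_bounded (hsum.mul_left _).hasSum fun m => ?_
    rw [norm_mul]
    refine mul_le_mul (norm_quadraticGaussSum_le ha m) ?_ (norm_nonneg _) (Real.sqrt_nonneg _)
    rw [norm_jacobiTheta₂_term, Complex.zero_im, mul_zero, sub_zero]
    apply Real.exp_le_exp.mpr
    have : 0 ≤ Real.pi * (m : ℝ) ^ 2 := by positivity
    nlinarith
  rw [hW, jacobiTheta₂_rational_translate_eq q a hτ, norm_mul, norm_div, norm_one,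
    show (1 / 2 : ℂ) = ((1 / 2 : ℝ) : ℂ) by norm_num, Complex.norm_cpow_real, ← Real.sqrt_eq_rpow,
    norm_mul, norm_neg, Complex.norm_I, one_mul, norm_mul, norm_pow, Complex.norm_natCast]
  set c := ∑' m : ℤ, Real.exp (-(Real.pi / 5) * m ^ 2)
  have hc : 0 ≤ c := tsum_nonneg fun m => (Real.exp_pos _).le
  have hkey : √(2 * q) * √(q * ((R ^ 2)⁻¹ + |β|)) ≤ 2 * √(q ^ 2 * ‖τ‖) := by
    rw [← Real.sqrt_mul (by positivity)]
    apply Real.sqrt_le_iff.mpr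
    refine ⟨by positivity, ?_⟩
    rw [mul_pow, Real.sq_sqrt (by positivity)]
    have : (q : ℝ) ^ 2 * (((R ^ 2)⁻¹ + |β|) / 2) ≤ q ^ 2 * ‖τ‖ := by gcongr
    nlinarith
  calc 1 / √(q ^ 2 * ‖τ‖) * _ ≤ 1 / √(q ^ 2 * ‖τ‖) * (√(2 * q) * c) := by gcongr
    _ = √(2 * q) * c / √(q ^ 2 * ‖τ‖) := by ring
    _ ≤ _ := by
      rw [div_le_div_iff₀ (by positivity) (by positivity)]
      nlinarith [mul_le_mul_of_nonneg_right hkey hc]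

/-- Every time is close to a rational with small denominator governing the Weyl sum. -/
lemma exists_rational_norm_gaussWeylSum_le : ∃ c : ℝ, 0 < c ∧ ∀ R t : ℝ, 1 ≤ R →
    ∃ (q : ℕ) (a : ℤ), 1 ≤ q ∧ q ≤ R ∧ |t - a / q| ≤ 1 ∧
      ‖gaussWeylSum R t‖ ≤ c / √(q * ((R ^ 2)⁻¹ + |t - a / q|)) := by
  refine ⟨2 * (∑' m : ℤ, Real.exp (-(Real.pi / 5) * m ^ 2)) + 1, ?_, fun R t hR => ?_⟩
  · have : 0 ≤ ∑' m : ℤ, Real.exp (-(Real.pi / 5) * (m : ℝ) ^ 2) :=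
      tsum_nonneg fun m => (Real.exp_pos _).le
    linarith
  -- Dirichlet with denominators up to ⌊R⌋; the error 1/((⌊R⌋ + 1)q) is below the 1/(Rq) needed.
  obtain ⟨x, hx1, hx2⟩ := Real.exists_rat_abs_sub_le_and_den_le t (Nat.floor_pos.mpr hR)
  have hxq : (x.den : ℝ) ≤ R := (Nat.cast_le.mpr hx2).trans (Nat.floor_le (by linarith))
  have : NeZero x.den := ⟨x.den_nz⟩
  have hq : (1 : ℝ) ≤ x.den := by exact_mod_cast x.den_pos
  have hxe : (x : ℝ) = x.num / x.den := by exact_mod_cast (Rat.num_div_den x).symm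
  rw [hxe] at hx1
  have hx3 : |t - x.num / x.den| ≤ 1 / (R * x.den) := by
    refine hx1.trans ?_
    gcongr
    exact (Nat.lt_floor_add_one R).le
  refine ⟨x.den, x.num, x.den_pos, hxq, hx3.trans ?_, ?_⟩
  · rw [div_le_one (by positivity)]
    nlinarith
  · refine (norm_gaussWeylSum_le_of_near hR hxq (Rat.isCoprime_num_den x) hx3).trans ?_
    gcongr
    linarith

/-! ### Mean values of the Weyl sum -/

/-- Because σ ≥ 2, the integrand is dominated by a rescaled Cauchy density. It is used with σ = s/2
and ε = R⁻², which is where s ≥ 4 enters. -/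
lemma lintegral_rpow_neg_add_abs_sub_le {ε σ : ℝ} (hε : 0 < ε) (hσ : 2 ≤ σ) (x : ℝ) :
    ∫⁻ t : ℝ, ENNReal.ofReal ((ε + |t - x|) ^ (-σ)) ≤
      ENNReal.ofReal (Real.pi * ε ^ (1 - σ)) := by
  rw [lintegral_sub_right_eq_self (fun t => ENNReal.ofReal ((ε + |t|) ^ (-σ))) x]
  have hpt : ∀ t : ℝ, (ε + |t|) ^ (-σ) ≤ ε ^ (-σ) * (1 + (t / ε) ^ 2)⁻¹ := by
    intro t
    have h0 : 0 < ε + |t| := by positivity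
    have h1 : (ε + |t|) ^ (-σ) = (ε + |t|) ^ (2 - σ) * ((ε + |t|) ^ 2)⁻¹ := by
      rw [← Real.rpow_natCast (ε + |t|) 2, ← Real.rpow_neg h0.le, ← Real.rpow_add h0]
      congr 1; push_cast; ring
    have h2 : ε ^ (-σ) = ε ^ (2 - σ) * (ε ^ 2)⁻¹ := by
      rw [← Real.rpow_natCast ε 2, ← Real.rpow_neg hε.le, ← Real.rpow_add hε]
      congr 1; push_cast; ring
    rw [h1, h2, mul_assoc, ← mul_inv]
    have h3 : (ε + |t|) ^ (2 - σ) ≤ ε ^ (2 - σ) :=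
      Real.rpow_le_rpow_of_nonpos hε (by linarith [abs_nonneg t]) (by linarith)
    have h4 : ε ^ 2 * (1 + (t / ε) ^ 2) ≤ (ε + |t|) ^ 2 := by
      have : ε ^ 2 * (1 + (t / ε) ^ 2) = ε ^ 2 + |t| ^ 2 := by
        rw [sq_abs]; field_simp
      rw [this]
      nlinarith [mul_nonneg hε.le (abs_nonneg t)]
    have h5 : 0 < ε ^ 2 * (1 + (t / ε) ^ 2) := by positivity
    exact mul_le_mul h3 (inv_anti₀ h5 h4) (by positivity) (by positivity)
  have hint : Integrable fun t : ℝ => ε ^ (-σ) * (1 + (t / ε) ^ 2)⁻¹ :=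
    ((integrable_inv_one_add_sq).comp_div hε.ne').const_mul _
  calc _ ≤ ∫⁻ t : ℝ, ENNReal.ofReal (ε ^ (-σ) * (1 + (t / ε) ^ 2)⁻¹) :=
        lintegral_mono fun t => ENNReal.ofReal_le_ofReal (hpt t)
    _ = ENNReal.ofReal (∫ t : ℝ, ε ^ (-σ) * (1 + (t / ε) ^ 2)⁻¹) :=
        (ofReal_integral_eq_lintegral_ofReal hint
          (Filter.Eventually.of_forall fun t => by positivity)).symm
    _ = _ := by
        congr 1
        rw [integral_const_mul, Measure.integral_comp_div (fun t => (1 + t ^ 2)⁻¹) ε,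
          integral_univ_inv_one_add_sq, smul_eq_mul, abs_of_pos hε, ← mul_assoc,
          show 1 - σ = -σ + 1 by ring, Real.rpow_add_one hε.ne', mul_comm]

/-- The `L^s` mean value of the Gaussian-weighted Weyl sum. -/
lemma exists_lintegral_gaussWeylSum_le {s T : ℝ} (hs : 4 ≤ s) (hT : 0 < T) :
    ∃ c : ℝ, 0 < c ∧ ∀ R : ℝ, 1 ≤ R →
      ∫⁻ t in Set.Icc (-T) T, ‖gaussWeylSum R t‖ₑ ^ s ≤
        ENNReal.ofReal (c * (R ^ (s - 2) * ∑ q ∈ Finset.Icc 1 ⌊R⌋₊, (q : ℝ) ^ (1 - s / 2))) := by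
  obtain ⟨c, hc, hW⟩ := exists_rational_norm_gaussWeylSum_le
  set B : ℕ := ⌈T + 1⌉₊ with hB
  have hTB : T + 1 ≤ B := Nat.le_ceil _
  refine ⟨3 * B * c ^ s * Real.pi, by
    have : (0 : ℝ) < B := by linarith
    positivity, fun R hR => ?_⟩
  have hR0 : 0 < R := by linarith
  set g : ℕ → ℤ → ℝ → ℝ≥0∞ := fun q a t =>
    ENNReal.ofReal (c ^ s * (q : ℝ) ^ (-(s / 2))) *
      ENNReal.ofReal (((R ^ 2)⁻¹ + |t - a / q|) ^ (-(s / 2))) with hg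
  have hgm : ∀ q a, Measurable (g q a) := fun q a => by
    simp only [hg]; fun_prop
  -- One fraction controls each t, so the sum over all of them dominates; overlapping arcs and
  -- unreduced fractions do no harm to an upper bound. The fraction has |a/q| ≤ T + 1 ≤ B.
  have hpt : ∀ t ∈ Set.Icc (-T) T, ‖gaussWeylSum R t‖ₑ ^ s ≤
      ∑ q ∈ Finset.Icc 1 ⌊R⌋₊, ∑ a ∈ Finset.Icc (-((B * q : ℕ) : ℤ)) (B * q : ℕ), g q a t := by
    intro t ht
    obtain ⟨q, a, hq1, hqR, hta, hb⟩ := hW R t hR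
    have hq0 : (1 : ℝ) ≤ q := by exact_mod_cast hq1
    have hqm : q ∈ Finset.Icc 1 ⌊R⌋₊ := Finset.mem_Icc.mpr ⟨hq1, Nat.le_floor hqR⟩
    have ham : a ∈ Finset.Icc (-((B * q : ℕ) : ℤ)) (B * q : ℕ) := by
      have h1 : |(a : ℝ) / q| ≤ B := by
        have := abs_sub_abs_le_abs_sub ((a : ℝ) / q) t
        rw [abs_sub_comm] at this
        have h2 : |t| ≤ T := abs_le.mpr ht
        linarith
      rw [abs_div, Nat.abs_cast, div_le_iff₀ (by linarith)] at h1
      rw [Finset.mem_Icc, ← abs_le]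
      exact_mod_cast h1
    have h1 : ‖gaussWeylSum R t‖ₑ ^ s ≤ g q a t := by
      rw [← ofReal_norm, ENNReal.ofReal_rpow_of_nonneg (norm_nonneg _) (by linarith), hg]
      simp only
      have hD : 0 < (R ^ 2)⁻¹ + |t - a / q| := by positivity
      rw [← ENNReal.ofReal_mul (by positivity)]
      apply ENNReal.ofReal_le_ofReal
      refine (Real.rpow_le_rpow (norm_nonneg _) hb (by linarith)).trans (le_of_eq ?_)
      rw [Real.div_rpow hc.le (Real.sqrt_nonneg _), Real.sqrt_eq_rpow, ← Real.rpow_mul (by positivity),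
        Real.mul_rpow (by positivity) hD.le, Real.rpow_neg (by positivity), Real.rpow_neg hD.le,
        show 1 / 2 * s = s / 2 by ring]
      field_simp
    refine h1.trans ?_
    refine le_trans ?_ (Finset.single_le_sum (f := fun q => ∑ a ∈ Finset.Icc (-((B * q : ℕ) : ℤ))
      (B * q : ℕ), g q a t) (fun _ _ => zero_le) hqm)
    exact Finset.single_le_sum (f := fun a => g q a t) (fun _ _ => zero_le) ham
  have hgi : ∀ q a, ∫⁻ t, g q a t ≤ ENNReal.ofReal (c ^ s * (q : ℝ) ^ (-(s / 2)) *
      (Real.pi * R ^ (s - 2))) := by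
    intro q a
    rw [lintegral_const_mul _ (by fun_prop), ENNReal.ofReal_mul (p := c ^ s * _) (by positivity)]
    gcongr
    refine (lintegral_rpow_neg_add_abs_sub_le (by positivity) (by linarith) _).trans (le_of_eq ?_)
    rw [Real.inv_rpow (by positivity), ← Real.rpow_natCast, ← Real.rpow_mul hR0.le,
      ← Real.rpow_neg hR0.le]
    congr 3
    push_cast
    ring
  calc _ ≤ ∫⁻ t in Set.Icc (-T) T, ∑ q ∈ Finset.Icc 1 ⌊R⌋₊,
        ∑ a ∈ Finset.Icc (-((B * q : ℕ) : ℤ)) (B * q : ℕ), g q a t :=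
        setLIntegral_mono' measurableSet_Icc hpt
    _ ≤ ∫⁻ t, ∑ q ∈ Finset.Icc 1 ⌊R⌋₊,
        ∑ a ∈ Finset.Icc (-((B * q : ℕ) : ℤ)) (B * q : ℕ), g q a t := setLIntegral_le_lintegral _ _
    _ = ∑ q ∈ Finset.Icc 1 ⌊R⌋₊, ∑ a ∈ Finset.Icc (-((B * q : ℕ) : ℤ)) (B * q : ℕ),
        ∫⁻ t, g q a t := by
        rw [lintegral_finsetSum _ fun q _ => Finset.measurable_sum _ fun a _ => hgm q a]
        exact Finset.sum_congr rfl fun q _ => lintegral_finsetSum _ fun a _ => hgm q a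
    _ ≤ ∑ q ∈ Finset.Icc 1 ⌊R⌋₊, ENNReal.ofReal (3 * B * c ^ s * Real.pi *
        (R ^ (s - 2) * (q : ℝ) ^ (1 - s / 2))) := by
        refine Finset.sum_le_sum fun q hq => ?_
        have hq1 : 1 ≤ q := (Finset.mem_Icc.mp hq).1
        have hq0 : (1 : ℝ) ≤ q := by exact_mod_cast hq1
        refine (Finset.sum_le_card_nsmul _ _ _ fun a _ => hgi q a).trans ?_
        rw [nsmul_eq_mul, ← ENNReal.ofReal_natCast, ← ENNReal.ofReal_mul (by positivity)]
        apply ENNReal.ofReal_le_ofReal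
        have hcard : ((Finset.Icc (-((B * q : ℕ) : ℤ)) (B * q : ℕ)).card : ℝ) ≤ 3 * B * q := by
          have hB1 : 1 ≤ B := by
            have : (1 : ℝ) ≤ B := by linarith
            exact_mod_cast this
          have : (Finset.Icc (-((B * q : ℕ) : ℤ)) (B * q : ℕ)).card ≤ 3 * B * q := by
            rw [Int.card_Icc]
            have : 1 ≤ B * q := Nat.mul_pos hB1 hq1
            rw [mul_assoc]
            omega
          exact_mod_cast this
        have e : (q : ℝ) ^ (1 - s / 2) = q * (q : ℝ) ^ (-(s / 2)) := by
          rw [sub_eq_add_neg, Real.rpow_add (by linarith), Real.rpow_one]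
        rw [e]
        calc _ ≤ 3 * B * q * (c ^ s * (q : ℝ) ^ (-(s / 2)) * (Real.pi * R ^ (s - 2))) := by
              gcongr
          _ = _ := by ring
    _ = _ := by
        rw [← ENNReal.ofReal_sum_of_nonneg fun q _ => by positivity, ← Finset.mul_sum,
          ← Finset.mul_sum]

/-- The truncation of `gaussWeylSum` to `|n| ≤ M`. -/
noncomputable def gaussWeylPoly (R : ℝ) (M : ℕ) (t : ℝ) : ℂ :=
  ∑ n ∈ Finset.Icc (-(M : ℤ)) M, (Real.exp (-Real.pi * n ^ 2 / R ^ 2) : ℂ) *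
    Complex.exp (2 * Real.pi * Complex.I * ((n : ℝ) ^ 2 * t : ℝ))

/-- The modulus of each theta term is independent of t, so one truncation leaves a tail at most 1
for all t. The TT* bound needs a finite sum, and M₀ lets the box contain prescribed frequencies. -/
lemma exists_norm_gaussWeylPoly_sub_le {R : ℝ} (hR : 1 ≤ R) (M₀ : ℕ) :
    ∃ M : ℕ, M₀ ≤ M ∧ ∀ t, ‖gaussWeylPoly R M t‖ ≤ ‖gaussWeylSum R t‖ + 1 := by
  have hR0 : 0 < R := by linarith
  have him : ∀ t : ℝ, (2 * t + Complex.I / R ^ 2 : ℂ).im = (R ^ 2)⁻¹ := fun t => by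
    have : (2 * t + Complex.I / R ^ 2 : ℂ) =
        ((2 * t : ℝ) : ℂ) + (((R ^ 2)⁻¹ : ℝ) : ℂ) * Complex.I := by push_cast; ring
    rw [this, Complex.add_im, Complex.ofReal_im, Complex.im_ofReal_mul]; simp
  have hpos : ∀ t : ℝ, 0 < (2 * t + Complex.I / R ^ 2 : ℂ).im := fun t => by
    rw [him]; positivity
  have hterm : ∀ (t : ℝ) (n : ℤ), jacobiTheta₂_term n 0 (2 * t + Complex.I / R ^ 2) =
      (Real.exp (-Real.pi * n ^ 2 / R ^ 2) : ℂ) *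
        Complex.exp (2 * Real.pi * Complex.I * ((n : ℝ) ^ 2 * t : ℝ)) := fun t n => by
    rw [jacobiTheta₂_term, Complex.ofReal_exp, ← Complex.exp_add]
    congr 1
    push_cast
    linear_combination (Real.pi * (n : ℂ) ^ 2 / R ^ 2) * Complex.I_sq
  have hnorm : ∀ (t : ℝ) (n : ℤ), ‖jacobiTheta₂_term n 0 (2 * t + Complex.I / R ^ 2)‖ =
      Real.exp (-Real.pi * n ^ 2 / R ^ 2) := fun t n => by
    rw [norm_jacobiTheta₂_term, him]
    congr 1
    simp
    ring
  have hsum : Summable fun n : ℤ => Real.exp (-Real.pi * n ^ 2 / R ^ 2) :=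
    ((summable_jacobiTheta₂_term_iff 0 _).mpr (hpos 0)).norm.congr fun n => hnorm 0 n
  obtain ⟨s₀, hs₀⟩ := (Metric.tendsto_atTop.mp hsum.hasSum) 1 one_pos
  obtain ⟨M, hM⟩ : ∃ M : ℕ, M₀ ≤ M ∧ s₀ ⊆ Finset.Icc (-(M : ℤ)) M := by
    refine ⟨max M₀ (s₀.sup Int.natAbs), le_max_left _ _, fun n hn => ?_⟩
    have h1 : n.natAbs ≤ s₀.sup Int.natAbs := Finset.le_sup (f := Int.natAbs) hn
    have h2 : n.natAbs ≤ max M₀ (s₀.sup Int.natAbs) := h1.trans (le_max_right _ _)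
    rw [Finset.mem_Icc]
    omega
  refine ⟨M, hM.1, fun t => ?_⟩
  have hs := hs₀ _ hM.2
  set F := Finset.Icc (-(M : ℤ)) M with hF
  have hθ := (summable_jacobiTheta₂_term_iff 0 _).mpr (hpos t)
  have h1 := hθ.sum_add_tsum_compl (s := F)
  have h2 := hsum.sum_add_tsum_compl (s := F)
  have h3 : ‖∑' n : ((F : Set ℤ)ᶜ : Set ℤ), jacobiTheta₂_term n 0 (2 * t + Complex.I / R ^ 2)‖ ≤
      ∑' n : ((F : Set ℤ)ᶜ : Set ℤ), Real.exp (-Real.pi * (n : ℤ) ^ 2 / R ^ 2) :=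
    tsum_of_norm_bounded (hsum.subtype _).hasSum fun n => (hnorm t n).le
  have h4 : ∑' n : ((F : Set ℤ)ᶜ : Set ℤ), Real.exp (-Real.pi * (n : ℤ) ^ 2 / R ^ 2) ≤ 1 := by
    rw [Real.dist_eq, ← h2] at hs
    have := (abs_lt.mp hs).1
    linarith
  have h5 : gaussWeylPoly R M t = gaussWeylSum R t -
      ∑' n : ((F : Set ℤ)ᶜ : Set ℤ), jacobiTheta₂_term n 0 (2 * t + Complex.I / R ^ 2) := by
    rw [gaussWeylSum, jacobiTheta₂, ← h1, add_sub_cancel_right, gaussWeylPoly]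
    exact Finset.sum_congr rfl fun n _ => (hterm t n).symm
  rw [h5]
  refine (norm_sub_le _ _).trans ?_
  linarith

lemma exists_lintegral_gaussWeylPoly_le {s T : ℝ} (hs : 4 ≤ s) (hT : 0 < T) :
    ∃ c : ℝ, 0 < c ∧ ∀ R : ℝ, 1 ≤ R → ∀ M₀ : ℕ, ∃ M : ℕ, M₀ ≤ M ∧
      ∫⁻ t in Set.Icc (-T) T, ‖gaussWeylPoly R M t‖ₑ ^ s ≤
        ENNReal.ofReal (c * (R ^ (s - 2) * ∑ q ∈ Finset.Icc 1 ⌊R⌋₊, (q : ℝ) ^ (1 - s / 2))) := by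
  obtain ⟨c, hc, hW⟩ := exists_lintegral_gaussWeylSum_le hs hT
  refine ⟨2 ^ (s - 1) * (c + 2 * T), by positivity, fun R hR M₀ => ?_⟩
  obtain ⟨M, hM, hMW⟩ := exists_norm_gaussWeylPoly_sub_le hR M₀
  refine ⟨M, hM, ?_⟩
  -- The term q = 1 already makes the bound at least 1, so it absorbs the truncation error.
  have hH : 1 ≤ R ^ (s - 2) * ∑ q ∈ Finset.Icc 1 ⌊R⌋₊, (q : ℝ) ^ (1 - s / 2) := by
    have h1 : 1 ≤ R ^ (s - 2) := Real.one_le_rpow hR (by linarith)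
    have h2 : (1 : ℝ) ≤ ∑ q ∈ Finset.Icc 1 ⌊R⌋₊, (q : ℝ) ^ (1 - s / 2) := by
      have : 1 ∈ Finset.Icc 1 ⌊R⌋₊ := Finset.mem_Icc.mpr ⟨le_rfl, Nat.floor_pos.mpr hR⟩
      refine le_trans ?_ (Finset.single_le_sum (fun q _ => by positivity) this)
      simp
    nlinarith
  set H := R ^ (s - 2) * ∑ q ∈ Finset.Icc 1 ⌊R⌋₊, (q : ℝ) ^ (1 - s / 2)
  have hpt : ∀ t, ‖gaussWeylPoly R M t‖ₑ ^ s ≤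
      (2 : ℝ≥0∞) ^ (s - 1) * (‖gaussWeylSum R t‖ₑ ^ s + 1) := by
    intro t
    have h1 : ‖gaussWeylPoly R M t‖ₑ ≤ ‖gaussWeylSum R t‖ₑ + 1 := by
      rw [← ofReal_norm, ← ofReal_norm, ← ENNReal.ofReal_one,
        ← ENNReal.ofReal_add (norm_nonneg _) zero_le_one]
      exact ENNReal.ofReal_le_ofReal (hMW t)
    calc _ ≤ (‖gaussWeylSum R t‖ₑ + 1) ^ s := ENNReal.rpow_le_rpow h1 (by linarith)
      _ ≤ _ := by
        have := ENNReal.rpow_add_le_mul_rpow_add_rpow ‖gaussWeylSum R t‖ₑ 1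
          (show 1 ≤ s by linarith)
        simpa using this
  calc _ ≤ ∫⁻ t in Set.Icc (-T) T, (2 : ℝ≥0∞) ^ (s - 1) * (‖gaussWeylSum R t‖ₑ ^ s + 1) :=
        lintegral_mono hpt
    _ = (2 : ℝ≥0∞) ^ (s - 1) * ((∫⁻ t in Set.Icc (-T) T, ‖gaussWeylSum R t‖ₑ ^ s) +
        ENNReal.ofReal (2 * T)) := by
        rw [lintegral_const_mul' _ _ (ENNReal.rpow_ne_top_of_nonneg (by linarith) (by simp)),
          lintegral_add_right _ measurable_const, setLIntegral_one, Real.volume_Icc]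
        congr 3
        ring
    _ ≤ ENNReal.ofReal (2 ^ (s - 1)) * (ENNReal.ofReal (c * H) + ENNReal.ofReal (2 * T)) := by
        rw [← ENNReal.ofReal_rpow_of_pos two_pos, ENNReal.ofReal_ofNat]
        gcongr
        exact hW R hR
    _ ≤ _ := by
        rw [← ENNReal.ofReal_add (by positivity) (by positivity),
          ← ENNReal.ofReal_mul (by positivity)]
        apply ENNReal.ofReal_le_ofReal
        rw [mul_assoc]
        gcongr
        nlinarith

lemma sum_Icc_rpow_le_one_add_log {R : ℝ} (hR : 1 ≤ R) :
    ∑ q ∈ Finset.Icc 1 ⌊R⌋₊, (q : ℝ) ^ (1 - (4 : ℝ) / 2) ≤ 1 + Real.log R := by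
  refine le_trans (le_of_eq ?_) (harmonic_floor_le_one_add_log R hR)
  rw [harmonic_eq_sum_Icc]
  push_cast
  refine Finset.sum_congr rfl fun q _ => ?_
  rw [show (1 - (4 : ℝ) / 2) = -1 by norm_num, Real.rpow_neg_one]

lemma exists_sum_Icc_rpow_le {s : ℝ} (hs : 4 < s) :
    ∃ c : ℝ, 0 < c ∧ ∀ R : ℝ, ∑ q ∈ Finset.Icc 1 ⌊R⌋₊, (q : ℝ) ^ (1 - s / 2) ≤ c := by
  have hsum : Summable fun q : ℕ => (q : ℝ) ^ (1 - s / 2) :=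
    Real.summable_nat_rpow.mpr (by linarith)
  have h0 : 0 ≤ ∑' q : ℕ, (q : ℝ) ^ (1 - s / 2) := tsum_nonneg fun q => by positivity
  exact ⟨∑' q : ℕ, (q : ℝ) ^ (1 - s / 2) + 1, by linarith, fun R =>
    (hsum.sum_le_tsum _ fun q _ => by positivity).trans (by linarith)⟩

/-! ### Young's inequality and the TT* bound -/

/-- A diagonal case of Young's convolution inequality on an interval. -/
lemma lintegral_prod_rpow_mul_convolution_le {ρ : ℝ} (hρ : 1 ≤ ρ) (a b : ℝ) {φ k : ℝ → ℝ≥0∞}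
    (hφ : Measurable φ) (hk : Measurable k) :
    ∫⁻ p, φ p.1 ^ (2 * ρ - 1) * φ p.2 ^ (2 * ρ - 1) * k (p.1 - p.2)
      ∂((volume.restrict (Set.Icc a b)).prod (volume.restrict (Set.Icc a b))) ≤
    (∫⁻ t in Set.Icc a b, φ t ^ (2 * ρ)) ^ (2 - 1 / ρ) *
      (∫⁻ t in Set.Icc (-(b - a)) (b - a), k t ^ ρ) ^ (1 / ρ) := by
  have hρ0 : 0 < ρ := by linarith
  have hinv : 1 / ρ ≤ 1 := by rw [div_le_one hρ0]; exact hρ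
  have hinv0 : 0 < 1 / ρ := by positivity
  set μ := volume.restrict (Set.Icc a b) with hμ
  set X := ∫⁻ t, φ t ^ (2 * ρ) ∂μ with hX
  set M := ∫⁻ t in Set.Icc (-(b - a)) (b - a), k t ^ ρ with hM
  set F : ℝ → ℝ≥0∞ := (Set.Icc (-(b - a)) (b - a)).indicator fun t => k t ^ ρ with hF
  have hFm : Measurable F := (hk.pow_const ρ).indicator measurableSet_Icc
  have hFM : ∫⁻ t, F t = M := lintegral_indicator measurableSet_Icc _
  have hin1 : ∀ t ∈ Set.Icc a b, ∫⁻ t', k (t - t') ^ ρ ∂μ ≤ M := by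
    intro t ht
    rw [← hFM, ← lintegral_sub_left_eq_self F t]
    refine (setLIntegral_mono' measurableSet_Icc fun t' ht' => ?_).trans
      (setLIntegral_le_lintegral _ _)
    rw [hF, Set.indicator_of_mem]
    exact ⟨by linarith [ht.1, ht'.2], by linarith [ht.2, ht'.1]⟩
  have hin2 : ∀ t' ∈ Set.Icc a b, ∫⁻ t, k (t - t') ^ ρ ∂μ ≤ M := by
    intro t' ht'
    rw [← hFM, ← lintegral_sub_right_eq_self F t']
    refine (setLIntegral_mono' measurableSet_Icc fun t ht => ?_).trans
      (setLIntegral_le_lintegral _ _)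
    rw [hF, Set.indicator_of_mem]
    exact ⟨by linarith [ht.1, ht'.2], by linarith [ht.2, ht'.1]⟩
  -- Three-factor Hölder with exponents 1 - 1/ρ, 1/(2ρ), 1/(2ρ): they sum to 1 and reproduce the
  -- powers 2ρ - 1, 2ρ - 1 and 1 of the integrand.
  set f : Fin 3 → ℝ × ℝ → ℝ≥0∞ := ![fun p => φ p.1 ^ (2 * ρ) * φ p.2 ^ (2 * ρ),
    fun p => φ p.1 ^ (2 * ρ) * k (p.1 - p.2) ^ ρ,
    fun p => φ p.2 ^ (2 * ρ) * k (p.1 - p.2) ^ ρ] with hf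
  set e : Fin 3 → ℝ := ![1 - 1 / ρ, 1 / (2 * ρ), 1 / (2 * ρ)] with he
  have hfm0 : Measurable (f 0) := by simp only [hf, Matrix.cons_val]; fun_prop
  have hfm1 : Measurable (f 1) := by simp only [hf, Matrix.cons_val]; fun_prop
  have hfm2 : Measurable (f 2) := by simp only [hf, Matrix.cons_val]; fun_prop
  have hholder := ENNReal.lintegral_prod_norm_pow_le (μ := μ.prod μ) (Finset.univ : Finset (Fin 3))
    (f := f) (p := e) (by
      intro i _
      fin_cases i
      · exact hfm0.aemeasurable
      · exact hfm1.aemeasurable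
      · exact hfm2.aemeasurable)
    (by simp only [Fin.sum_univ_three, he, Matrix.cons_val]; field_simp; ring)
    (by
      intro i _
      fin_cases i
      · simp only [he]; show 0 ≤ 1 - 1 / ρ; linarith
      · show 0 ≤ 1 / (2 * ρ); positivity
      · show 0 ≤ 1 / (2 * ρ); positivity)
  simp only [Fin.prod_univ_three, hf, he, Matrix.cons_val] at hholder
  have h0 : ∫⁻ p : ℝ × ℝ, φ p.1 ^ (2 * ρ) * φ p.2 ^ (2 * ρ) ∂(μ.prod μ) = X * X :=
    lintegral_prod_mul (hφ.pow_const _).aemeasurable (hφ.pow_const _).aemeasurable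
  have h1 : ∫⁻ p : ℝ × ℝ, φ p.1 ^ (2 * ρ) * k (p.1 - p.2) ^ ρ ∂(μ.prod μ) ≤ X * M := by
    rw [lintegral_prod _ (by fun_prop)]
    calc _ = ∫⁻ t, φ t ^ (2 * ρ) * ∫⁻ t', k (t - t') ^ ρ ∂μ ∂μ :=
          lintegral_congr fun t => lintegral_const_mul _ (by fun_prop)
      _ ≤ ∫⁻ t, φ t ^ (2 * ρ) * M ∂μ :=
          setLIntegral_mono' measurableSet_Icc fun t ht => mul_le_mul_right (hin1 t ht) _
      _ = X * M := lintegral_mul_const _ (by fun_prop)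
  have h2 : ∫⁻ p : ℝ × ℝ, φ p.2 ^ (2 * ρ) * k (p.1 - p.2) ^ ρ ∂(μ.prod μ) ≤ X * M := by
    rw [lintegral_prod_symm _ (by fun_prop)]
    calc _ = ∫⁻ t', φ t' ^ (2 * ρ) * ∫⁻ t, k (t - t') ^ ρ ∂μ ∂μ :=
          lintegral_congr fun t => lintegral_const_mul _ (by fun_prop)
      _ ≤ ∫⁻ t', φ t' ^ (2 * ρ) * M ∂μ :=
          setLIntegral_mono' measurableSet_Icc fun t ht => mul_le_mul_right (hin2 t ht) _
      _ = X * M := lintegral_mul_const _ (by fun_prop)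
  calc _ = ∫⁻ p : ℝ × ℝ, (φ p.1 ^ (2 * ρ) * φ p.2 ^ (2 * ρ)) ^ (1 - 1 / ρ) *
          (φ p.1 ^ (2 * ρ) * k (p.1 - p.2) ^ ρ) ^ (1 / (2 * ρ)) *
          (φ p.2 ^ (2 * ρ) * k (p.1 - p.2) ^ ρ) ^ (1 / (2 * ρ)) ∂(μ.prod μ) := by
        refine lintegral_congr fun p => ?_
        have g1 : ∀ x : ℝ≥0∞, (x ^ (2 * ρ)) ^ (1 - 1 / ρ) * (x ^ (2 * ρ)) ^ (1 / (2 * ρ)) =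
            x ^ (2 * ρ - 1) := fun x => by
          rw [← ENNReal.rpow_add_of_nonneg _ _ (by linarith) (by positivity), ← ENNReal.rpow_mul]
          congr 1
          field_simp
          ring
        have g2 : ∀ x : ℝ≥0∞, (x ^ ρ) ^ (1 / (2 * ρ)) * (x ^ ρ) ^ (1 / (2 * ρ)) = x := fun x => by
          rw [← ENNReal.rpow_add_of_nonneg _ _ (by positivity) (by positivity), ← ENNReal.rpow_mul]
          convert ENNReal.rpow_one x using 2
          field_simp
          ring
        simp only [ENNReal.mul_rpow_of_nonneg _ _ (show 0 ≤ 1 - 1 / ρ by linarith),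
          ENNReal.mul_rpow_of_nonneg _ _ (show 0 ≤ 1 / (2 * ρ) by positivity)]
        rw [← g1 (φ p.1), ← g1 (φ p.2)]
        nth_rewrite 1 [← g2 (k (p.1 - p.2))]
        ring
    _ ≤ _ := hholder
    _ ≤ (X * X) ^ (1 - 1 / ρ) * (X * M) ^ (1 / (2 * ρ)) * (X * M) ^ (1 / (2 * ρ)) := by
        rw [h0]; gcongr
    _ = X ^ (2 - 1 / ρ) * M ^ (1 / ρ) := by
        rw [mul_assoc, ← ENNReal.rpow_add_of_nonneg _ _ (by positivity) (by positivity),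
          show 1 / (2 * ρ) + 1 / (2 * ρ) = 1 / ρ by field_simp; ring,
          ENNReal.mul_rpow_of_nonneg _ _ (show 0 ≤ 1 - 1 / ρ by linarith),
          ENNReal.mul_rpow_of_nonneg _ _ hinv0.le, ← mul_assoc,
          ← ENNReal.rpow_add_of_nonneg _ _ (by linarith) (by linarith),
          ← ENNReal.rpow_add_of_nonneg _ _ (by linarith) (by linarith)]
        congr 2
        ring

/-- The exponential sum `∑ₖ cₖ e(ωₖ t)` over a finite index set. -/
noncomputable def expSum {ι : Type*} (S : Finset ι) (ω : ι → ℝ) (c : ι → ℂ) (t : ℝ) : ℂ :=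
  ∑ k ∈ S, c k * Complex.exp (2 * Real.pi * Complex.I * (ω k * t : ℝ))

lemma continuous_expSum {ι : Type*} (S : Finset ι) (ω : ι → ℝ) (c : ι → ℂ) :
    Continuous (expSum S ω c) := by
  unfold expSum
  fun_prop

lemma norm_exp_two_pi_mul (x : ℝ) : ‖Complex.exp (2 * Real.pi * Complex.I * (x : ℝ))‖ = 1 := by
  rw [show (2 * Real.pi * Complex.I * (x : ℝ) : ℂ) = ((2 * Real.pi * x : ℝ) : ℂ) * Complex.I by
    push_cast; ring, Complex.norm_exp_ofReal_mul_I]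

lemma conj_exp_two_pi_mul (x : ℝ) :
    starRingEnd ℂ (Complex.exp (2 * Real.pi * Complex.I * (x : ℝ))) =
      Complex.exp (2 * Real.pi * Complex.I * (-x : ℝ)) := by
  rw [← Complex.exp_conj]
  congr 1
  simp [map_ofNat]

/-- The weighted energy of the Fourier transform of `g` on an interval is controlled by the
kernel of the weights. -/
lemma ofReal_sum_weight_mul_normSq_le {ι : Type*} (S : Finset ι) (ω w : ι → ℝ)
    (a b : ℝ) {g : ℝ → ℂ} (hg : Continuous g) :
    ENNReal.ofReal (∑ k ∈ S, w k * ‖∫ t in Set.Icc a b,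
      g t * Complex.exp (2 * Real.pi * Complex.I * (-(ω k * t) : ℝ))‖ ^ 2) ≤
    ∫⁻ p, ‖g p.1‖ₑ * ‖g p.2‖ₑ * ‖expSum S ω (fun k => (w k : ℂ)) (p.1 - p.2)‖ₑ
      ∂((volume.restrict (Set.Icc a b)).prod (volume.restrict (Set.Icc a b))) := by
  set μ := volume.restrict (Set.Icc a b) with hμ
  set G : ι → ℝ → ℂ := fun k t =>
    g t * Complex.exp (2 * Real.pi * Complex.I * (-(ω k * t) : ℝ)) with hG
  have hGc : ∀ k, Continuous (G k) := fun k => by simp only [hG]; fun_prop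
  have hGi : ∀ k, Integrable (G k) μ := fun k => (hGc k).continuousOn.integrableOn_compact isCompact_Icc
  have hGi' : ∀ k, Integrable (fun t => starRingEnd ℂ (G k t)) μ := fun k =>
    (Complex.continuous_conj.comp (hGc k)).continuousOn.integrableOn_compact isCompact_Icc
  have hsq : ∀ k, ((w k * ‖∫ t, G k t ∂μ‖ ^ 2 : ℝ) : ℂ) =
      ∫ p, (w k : ℂ) * (G k p.1 * starRingEnd ℂ (G k p.2)) ∂(μ.prod μ) := fun k => by
    rw [integral_const_mul, integral_prod_mul (G k) (fun t => starRingEnd ℂ (G k t)),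
      integral_conj, Complex.mul_conj, Complex.normSq_eq_norm_sq]
    push_cast
    rfl
  have hsum : ((∑ k ∈ S, w k * ‖∫ t, G k t ∂μ‖ ^ 2 : ℝ) : ℂ) =
      ∫ p, ∑ k ∈ S, (w k : ℂ) * (G k p.1 * starRingEnd ℂ (G k p.2)) ∂(μ.prod μ) := by
    rw [integral_finsetSum _ fun k _ => ((hGi k).mul_prod (hGi' k)).const_mul _, Complex.ofReal_sum]
    exact Finset.sum_congr rfl fun k _ => hsq k
  calc _ ≤ ‖((∑ k ∈ S, w k * ‖∫ t, G k t ∂μ‖ ^ 2 : ℝ) : ℂ)‖ₑ := by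
        rw [← ofReal_norm, Complex.norm_real]
        exact ENNReal.ofReal_le_ofReal (le_abs_self _)
    _ ≤ ∫⁻ p, ‖∑ k ∈ S, (w k : ℂ) * (G k p.1 * starRingEnd ℂ (G k p.2))‖ₑ ∂(μ.prod μ) := by
        rw [hsum]
        exact enorm_integral_le_lintegral_enorm _
    _ = _ := by
        refine lintegral_congr fun p => ?_
        have : ∑ k ∈ S, (w k : ℂ) * (G k p.1 * starRingEnd ℂ (G k p.2)) =
            g p.1 * starRingEnd ℂ (g p.2) *
              starRingEnd ℂ (expSum S ω (fun k => (w k : ℂ)) (p.1 - p.2)) := by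
          rw [expSum, map_sum, Finset.mul_sum]
          refine Finset.sum_congr rfl fun k _ => ?_
          simp only [hG, map_mul, conj_exp_two_pi_mul, Complex.conj_ofReal]
          rw [show (2 * Real.pi * Complex.I * (-(ω k * (p.1 - p.2)) : ℝ) : ℂ) =
            2 * Real.pi * Complex.I * (-(ω k * p.1) : ℝ) +
            2 * Real.pi * Complex.I * (-(-(ω k * p.2)) : ℝ) by push_cast; ring, Complex.exp_add]
          ring
        rw [this, enorm_mul, enorm_mul, RCLike.enorm_conj, RCLike.enorm_conj]

/-- The `TT*` bound: the `L^{2ρ}` norm of an exponential sum on an interval is controlled by the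
`L^ρ` norm of a majorising kernel with the same frequencies. -/
theorem lintegral_expSum_rpow_le {ι : Type*} (S : Finset ι) (ω w : ι → ℝ) (c : ι → ℂ)
    (hw0 : ∀ k ∈ S, 0 ≤ w k) (hw : ∀ k ∈ S, c k ≠ 0 → 1 ≤ w k) {ρ : ℝ} (hρ : 1 ≤ ρ) (a b : ℝ) :
    (∫⁻ t in Set.Icc a b, ‖expSum S ω c t‖ₑ ^ (2 * ρ)) ^ (1 / ρ) ≤
      ENNReal.ofReal (∑ k ∈ S, ‖c k‖ ^ 2) *
        (∫⁻ t in Set.Icc (-(b - a)) (b - a),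
          ‖expSum S ω (fun k => (w k : ℂ)) t‖ₑ ^ ρ) ^ (1 / ρ) := by
  have hρ0 : 0 < ρ := by linarith
  have hinv : 1 / ρ ≤ 1 := by rw [div_le_one hρ0]; exact hρ
  have hinv0 : 0 < 1 / ρ := by positivity
  set F := expSum S ω c with hF
  set K := expSum S ω (fun k => (w k : ℂ)) with hK
  have hFc : Continuous F := continuous_expSum S ω c
  have hKc : Continuous K := continuous_expSum _ _ _
  set μ := volume.restrict (Set.Icc a b) with hμ
  have hcont : Continuous fun t => ‖F t‖ ^ (2 * ρ) :=
    hFc.norm.rpow_const fun _ => Or.inr (by linarith)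
  have hint : Integrable (fun t => ‖F t‖ ^ (2 * ρ)) μ :=
    hcont.continuousOn.integrableOn_compact isCompact_Icc
  set x := ∫ t, ‖F t‖ ^ (2 * ρ) ∂μ with hx
  have hx0 : 0 ≤ x := integral_nonneg fun t => by positivity
  have hX : ∫⁻ t, ‖F t‖ₑ ^ (2 * ρ) ∂μ = ENNReal.ofReal x := by
    rw [hx, ofReal_integral_eq_lintegral_ofReal hint
      (Filter.Eventually.of_forall fun t => by positivity)]
    refine lintegral_congr fun t => ?_
    rw [← ofReal_norm, ENNReal.ofReal_rpow_of_nonneg (norm_nonneg _) (by linarith)]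
  -- The dual function of F: the integral of F times the conjugate of g is the 2ρ-th power of the
  -- norm.
  set g : ℝ → ℂ := fun t => F t * (‖F t‖ ^ (2 * ρ - 2) : ℝ) with hg
  have hgc : Continuous g := hFc.mul (Complex.continuous_ofReal.comp
    (hFc.norm.rpow_const fun _ => Or.inr (by linarith)))
  have hgn : ∀ t, ‖g t‖ = ‖F t‖ ^ (2 * ρ - 1) := fun t => by
    rw [hg]
    simp only
    rw [norm_mul, Complex.norm_real, Real.norm_of_nonneg (by positivity)]
    rcases eq_or_ne (F t) 0 with h | h
    · rw [h, norm_zero, zero_mul, Real.zero_rpow (by linarith)]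
    · rw [show 2 * ρ - 1 = 1 + (2 * ρ - 2) by ring, Real.rpow_add (norm_pos_iff.mpr h),
        Real.rpow_one]
  have hge : ∀ t, ‖g t‖ₑ = ‖F t‖ₑ ^ (2 * ρ - 1) := fun t => by
    rw [← ofReal_norm, ← ofReal_norm, ENNReal.ofReal_rpow_of_nonneg (norm_nonneg _) (by linarith),
      hgn]
  set γ : ι → ℂ := fun k => ∫ t, g t * Complex.exp (2 * Real.pi * Complex.I * (-(ω k * t) : ℝ)) ∂μ
    with hγ
  have hFg : ∀ t, F t * starRingEnd ℂ (g t) = ((‖F t‖ ^ (2 * ρ) : ℝ) : ℂ) := fun t => by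
    rw [hg]
    simp only [map_mul, Complex.conj_ofReal]
    rw [← mul_assoc, Complex.mul_conj, Complex.normSq_eq_norm_sq, ← Complex.ofReal_mul]
    congr 1
    rcases eq_or_ne (F t) 0 with h | h
    · rw [h, norm_zero, Real.zero_rpow (show 2 * ρ ≠ 0 by linarith)]; simp
    · rw [← Real.rpow_natCast, ← Real.rpow_add (norm_pos_iff.mpr h)]
      congr 1; push_cast; ring
  have hxsum : (x : ℂ) = ∑ k ∈ S, c k * starRingEnd ℂ (γ k) := by
    rw [hx, ← integral_complex_ofReal]
    simp_rw [← hFg]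
    rw [hF]
    simp_rw [expSum, Finset.sum_mul]
    rw [integral_finsetSum]
    · refine Finset.sum_congr rfl fun k _ => ?_
      rw [hγ]
      simp only
      rw [← integral_conj, ← integral_const_mul]
      refine integral_congr_ae (Filter.Eventually.of_forall fun t => ?_)
      simp only [map_mul, conj_exp_two_pi_mul, neg_neg]
      ring
    · intro k _
      refine Continuous.integrableOn_Icc ?_
      fun_prop
  -- Cauchy–Schwarz; the weights may be inserted because only k with c k ≠ 0 contribute, and there w
  -- k ≥ 1.
  have hxle : x ^ 2 ≤ (∑ k ∈ S, ‖c k‖ ^ 2) * ∑ k ∈ S, w k * ‖γ k‖ ^ 2 := by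
    have h1 : x ≤ ∑ k ∈ S, ‖c k‖ * (√(w k) * ‖γ k‖) := by
      calc x = ‖(x : ℂ)‖ := by rw [Complex.norm_real, Real.norm_of_nonneg hx0]
        _ ≤ ∑ k ∈ S, ‖c k * starRingEnd ℂ (γ k)‖ := by rw [hxsum]; exact norm_sum_le _ _
        _ ≤ _ := Finset.sum_le_sum fun k hk => by
          rw [norm_mul, RCLike.norm_conj]
          rcases eq_or_ne (c k) 0 with h | h
          · simp [h]
          · have : 1 ≤ √(w k) := Real.one_le_sqrt.mpr (hw k hk h)
            gcongr
            exact le_mul_of_one_le_left (norm_nonneg _) this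
    calc x ^ 2 ≤ (∑ k ∈ S, ‖c k‖ * (√(w k) * ‖γ k‖)) ^ 2 := by gcongr
      _ ≤ (∑ k ∈ S, ‖c k‖ ^ 2) * ∑ k ∈ S, (√(w k) * ‖γ k‖) ^ 2 := Finset.sum_mul_sq_le_sq_mul_sq _ _ _
      _ = _ := by
        congr 1
        refine Finset.sum_congr rfl fun k hk => ?_
        rw [mul_pow, Real.sq_sqrt (hw0 k hk)]
  have hen : ENNReal.ofReal (∑ k ∈ S, w k * ‖γ k‖ ^ 2) ≤
      (ENNReal.ofReal x) ^ (2 - 1 / ρ) *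
        (∫⁻ t in Set.Icc (-(b - a)) (b - a), ‖K t‖ₑ ^ ρ) ^ (1 / ρ) := by
    refine (ofReal_sum_weight_mul_normSq_le S ω w a b hgc).trans ?_
    simp_rw [hge, ← hX]
    exact lintegral_prod_rpow_mul_convolution_le hρ a b hFc.measurable.enorm hKc.measurable.enorm
  rw [hX]
  -- The rest divides x² ≤ ‖c‖² x^{2-1/ρ} ‖K‖_ρ by x^{2-1/ρ}, so x = 0 is set apart.
  rcases hx0.eq_or_lt with h | h
  · rw [← h, ENNReal.ofReal_zero, ENNReal.zero_rpow_of_pos hinv0]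
    exact zero_le
  have hXpos : ENNReal.ofReal x ≠ 0 := (ENNReal.ofReal_pos.mpr h).ne'
  have hne0 : (ENNReal.ofReal x) ^ (2 - 1 / ρ) ≠ 0 :=
    (ENNReal.rpow_pos (ENNReal.ofReal_pos.mpr h) ENNReal.ofReal_ne_top).ne'
  have hnet : (ENNReal.ofReal x) ^ (2 - 1 / ρ) ≠ ⊤ :=
    ENNReal.rpow_ne_top_of_nonneg (by linarith) ENNReal.ofReal_ne_top
  have hfin : (ENNReal.ofReal x) ^ (2 - 1 / ρ) * (ENNReal.ofReal x) ^ (1 / ρ) ≤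
      (ENNReal.ofReal x) ^ (2 - 1 / ρ) * (ENNReal.ofReal (∑ k ∈ S, ‖c k‖ ^ 2) *
        (∫⁻ t in Set.Icc (-(b - a)) (b - a), ‖K t‖ₑ ^ ρ) ^ (1 / ρ)) := by
    rw [← ENNReal.rpow_add_of_nonneg _ _ (by linarith) hinv0.le, sub_add_cancel,
      ENNReal.ofReal_rpow_of_nonneg hx0 (by norm_num), Real.rpow_two]
    calc _ ≤ _ := ENNReal.ofReal_le_ofReal hxle
      _ = ENNReal.ofReal (∑ k ∈ S, ‖c k‖ ^ 2) * ENNReal.ofReal (∑ k ∈ S, w k * ‖γ k‖ ^ 2) :=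
        ENNReal.ofReal_mul (Finset.sum_nonneg fun k _ => by positivity)
      _ ≤ ENNReal.ofReal (∑ k ∈ S, ‖c k‖ ^ 2) * ((ENNReal.ofReal x) ^ (2 - 1 / ρ) *
          (∫⁻ t in Set.Icc (-(b - a)) (b - a), ‖K t‖ₑ ^ ρ) ^ (1 / ρ)) := by gcongr
      _ = _ := by ring
  exact (ENNReal.mul_le_mul_iff_right hne0 hnet).mp hfin

/-! ### The Gaussian kernel and the restriction estimate in time -/

/-- The kernel with Gaussian weights on a box factorises into one-dimensional Weyl sums. -/
lemma expSum_gaussian_box {d : ℕ} (θ : Fin d → ℝ) (R D : ℝ) (M : ℕ) (t : ℝ) :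
    expSum (Fintype.piFinset fun _ : Fin d => Finset.Icc (-(M : ℤ)) M)
      (fun k => quadForm θ k / 2)
      (fun k => ((D * ∏ j, Real.exp (-Real.pi * (k j) ^ 2 / R ^ 2) : ℝ) : ℂ)) t =
    D * ∏ j, gaussWeylPoly R M (θ j / 2 * t) := by
  simp only [gaussWeylPoly]
  rw [Finset.prod_univ_sum, expSum, Finset.mul_sum]
  refine Finset.sum_congr rfl fun k _ => ?_
  rw [Finset.prod_mul_distrib, ← Complex.exp_sum, ← Finset.mul_sum, ← Complex.ofReal_sum,
    Complex.ofReal_mul, Complex.ofReal_prod, mul_assoc]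
  congr 6
  rw [quadForm, Finset.sum_div, Finset.sum_mul]
  refine Finset.sum_congr rfl fun j _ => ?_
  ring

lemma setLIntegral_comp_mul_left_le {g : ℝ → ℝ≥0∞} (hg : Measurable g) {x C L : ℝ} (hC : 1 ≤ C)
    (hx1 : 1 / C ≤ x) (hx2 : x ≤ C) :
    ∫⁻ t in Set.Icc (-L) L, g (x / 2 * t) ≤
      ENNReal.ofReal (2 * C) * ∫⁻ t in Set.Icc (-(L * C)) (L * C), g t := by
  have hC0 : 0 < C := by linarith
  have hx0 : 0 < x := lt_of_lt_of_le (by positivity) hx1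
  rw [← lintegral_indicator measurableSet_Icc, ← lintegral_indicator measurableSet_Icc]
  set G := (Set.Icc (-(L * C)) (L * C)).indicator g with hG
  have hGm : Measurable G := hg.indicator measurableSet_Icc
  have hmap := Real.map_volume_mul_left (a := x / 2) (by positivity)
  have h1 : ∫⁻ t, G (x / 2 * t) = ENNReal.ofReal |(x / 2)⁻¹| * ∫⁻ t, G t := by
    rw [← lintegral_map hGm (measurable_const_mul _), hmap, lintegral_smul_measure, smul_eq_mul]
  calc _ ≤ ∫⁻ t, G (x / 2 * t) := by
        refine lintegral_mono fun t => ?_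
        refine Set.indicator_apply_le' (fun ht => ?_) fun _ => zero_le
        rw [hG, Set.indicator_of_mem]
        rw [Set.mem_Icc, ← abs_le] at ht ⊢
        rw [abs_mul, abs_of_pos (by positivity), mul_comm L]
        gcongr
        linarith
    _ = _ := h1
    _ ≤ _ := by
        gcongr
        rw [abs_of_pos (by positivity), inv_div]
        rw [div_le_iff₀ hx0]
        rw [div_le_iff₀ hC0] at hx1
        linarith

/-- Hölder's inequality for a product of `d` functions, each in `L^{dρ}`. -/
lemma lintegral_prod_rpow_le {d : ℕ} (hd : 0 < d) {ρ : ℝ} (hρ : 0 ≤ ρ) {μ : Measure ℝ}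
    {g : Fin d → ℝ → ℝ≥0∞} (hg : ∀ j, Measurable (g j)) {A : ℝ≥0∞}
    (hA : ∀ j, ∫⁻ t, g j t ^ (d * ρ) ∂μ ≤ A) :
    ∫⁻ t, (∏ j, g j t) ^ ρ ∂μ ≤ A := by
  have hd0 : (0 : ℝ) < d := by exact_mod_cast hd
  have hcard : ∑ _j : Fin d, (1 / d : ℝ) = 1 := by
    rw [Finset.sum_const, Finset.card_univ, Fintype.card_fin, nsmul_eq_mul]
    field_simp
  have h := ENNReal.lintegral_prod_norm_pow_le (μ := μ) (Finset.univ : Finset (Fin d))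
    (f := fun j t => g j t ^ (d * ρ)) (p := fun _ => (1 / d : ℝ))
    (fun j _ => ((hg j).pow_const _).aemeasurable) hcard (fun _ _ => by positivity)
  calc _ = ∫⁻ t, ∏ j, (g j t ^ (d * ρ)) ^ (1 / d : ℝ) ∂μ := by
        refine lintegral_congr fun t => ?_
        rw [← ENNReal.prod_rpow_of_nonneg hρ]
        refine Finset.prod_congr rfl fun j _ => ?_
        rw [← ENNReal.rpow_mul]
        congr 1
        field_simp
    _ ≤ _ := h
    _ ≤ ∏ _j : Fin d, A ^ (1 / d : ℝ) :=
        Finset.prod_le_prod' fun j _ => ENNReal.rpow_le_rpow (hA j) (by positivity)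
    _ = A := by
        rw [Finset.prod_const, Finset.card_univ, Fintype.card_fin, ← ENNReal.rpow_natCast,
          ← ENNReal.rpow_mul]
        convert ENNReal.rpow_one A using 2
        field_simp

/-- The restriction estimate in time for exponential sums with frequencies `Q(k) / 2`. -/
theorem exists_lintegral_quadForm_expSum_le {d : ℕ} (hd : 0 < d) {ρ C L : ℝ} (hρ : 1 ≤ ρ)
    (hs : 4 ≤ d * ρ) (hC : 1 ≤ C) (hL : 0 < L) :
    ∃ c : ℝ, 0 < c ∧ ∀ θ : Fin d → ℝ, (∀ j, 1 / C ≤ θ j ∧ θ j ≤ C) → ∀ a b : ℝ, b - a = L →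
      ∀ R : ℝ, 1 ≤ R → ∀ (S : Finset (Fin d → ℤ)) (α : (Fin d → ℤ) → ℂ),
      (∀ k ∈ S, ∀ j, |(k j : ℝ)| ≤ R) →
      (∫⁻ t in Set.Icc a b, ‖expSum S (fun k => quadForm θ k / 2) α t‖ₑ ^ (2 * ρ)) ^ (1 / ρ) ≤
        ENNReal.ofReal (c * (R ^ (d * ρ - 2) *
          ∑ q ∈ Finset.Icc 1 ⌊R⌋₊, (q : ℝ) ^ (1 - d * ρ / 2)) ^ (1 / ρ) *
          ∑ k ∈ S, ‖α k‖ ^ 2) := by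
  have hC0 : 0 < C := by linarith
  have hρ0 : 0 < ρ := by linarith
  obtain ⟨c, hc, hW⟩ := exists_lintegral_gaussWeylPoly_le hs (show 0 < L * C by positivity)
  -- Each Gaussian factor is at least exp(-π) when |k j| ≤ R; D compensates all d of them.
  set D : ℝ := Real.exp (Real.pi) ^ d with hD
  have hD0 : 0 < D := by positivity
  refine ⟨D * (2 * C * c) ^ (1 / ρ), by positivity, fun θ hθ a b hab R hR S α hS => ?_⟩
  have hR0 : 0 < R := by linarith
  obtain ⟨M, hM, hMW⟩ := hW R hR ⌈R⌉₊
  set Φ := R ^ (d * ρ - 2) * ∑ q ∈ Finset.Icc 1 ⌊R⌋₊, (q : ℝ) ^ (1 - d * ρ / 2) with hΦ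
  have hΦ0 : 0 ≤ Φ := by positivity
  have hMR : R ≤ M := (Nat.le_ceil R).trans (by exact_mod_cast hM)
  set B := Fintype.piFinset fun _ : Fin d => Finset.Icc (-(M : ℤ)) M with hB
  set ω : (Fin d → ℤ) → ℝ := fun k => quadForm θ k / 2 with hω
  set w : (Fin d → ℤ) → ℝ := fun k => D * ∏ j, Real.exp (-Real.pi * (k j) ^ 2 / R ^ 2) with hw
  have hSB : S ⊆ B := fun k hk => by
    rw [hB, Fintype.mem_piFinset]
    intro j
    rw [Finset.mem_Icc, ← abs_le]
    have := (hS k hk j).trans hMR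
    exact_mod_cast this
  classical
  -- Extending by zero to the full box is what lets the kernel factorise over coordinates.
  set β : (Fin d → ℤ) → ℂ := fun k => if k ∈ S then α k else 0 with hβ
  have hsum : ∑ k ∈ B, ‖β k‖ ^ 2 = ∑ k ∈ S, ‖α k‖ ^ 2 := by
    rw [← Finset.sum_subset hSB fun k _ hk => by simp [hβ, hk]]
    exact Finset.sum_congr rfl fun k hk => by simp [hβ, hk]
  have hexp : ∀ t, expSum B ω β t = expSum S ω α t := fun t => by
    rw [expSum, expSum, ← Finset.sum_subset hSB fun k _ hk => by simp [hβ, hk]]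
    exact Finset.sum_congr rfl fun k hk => by simp [hβ, hk]
  have hw1 : ∀ k ∈ B, β k ≠ 0 → 1 ≤ w k := fun k _ hk => by
    have hkS : k ∈ S := by
      by_contra h
      exact hk (by simp [hβ, h])
    rw [hw, hD]
    simp only
    rw [show Real.exp Real.pi ^ d = ∏ _j : Fin d, Real.exp Real.pi by simp,
      ← Finset.prod_mul_distrib, ← Finset.prod_const_one (s := (Finset.univ : Finset (Fin d)))]
    refine Finset.prod_le_prod (fun _ _ => zero_le_one) fun j _ => ?_
    rw [← Real.exp_add]
    apply Real.one_le_exp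
    have h1 : (k j : ℝ) ^ 2 / R ^ 2 ≤ 1 := by
      rw [div_le_one (by positivity)]
      exact sq_le_sq' (abs_le.mp (hS k hkS j)).1 (abs_le.mp (hS k hkS j)).2
    rw [mul_div_assoc]
    nlinarith [Real.pi_pos]
  have hmain := lintegral_expSum_rpow_le B ω w β (fun k _ => by positivity) hw1 hρ a b
  rw [hsum, hab] at hmain
  simp_rw [hexp] at hmain
  refine hmain.trans ?_
  have hgm : Measurable fun t => ‖gaussWeylPoly R M t‖ₑ := by
    unfold gaussWeylPoly
    fun_prop
  have hK : ∫⁻ t in Set.Icc (-L) L, ‖expSum B ω (fun k => (w k : ℂ)) t‖ₑ ^ ρ ≤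
      ENNReal.ofReal (D ^ ρ * (2 * C * (c * Φ))) := by
    calc _ = ∫⁻ t in Set.Icc (-L) L, ENNReal.ofReal (D ^ ρ) *
          (∏ j, ‖gaussWeylPoly R M (θ j / 2 * t)‖ₑ) ^ ρ := by
          refine lintegral_congr fun t => ?_
          rw [expSum_gaussian_box, enorm_mul, ENNReal.mul_rpow_of_nonneg _ _ hρ0.le,
            ← ENNReal.ofReal_rpow_of_pos hD0, ← ofReal_norm, Complex.norm_real,
            Real.norm_of_nonneg hD0.le]
          congr 2
          simp only [← ofReal_norm, norm_prod]
          rw [ENNReal.ofReal_prod_of_nonneg fun _ _ => norm_nonneg _]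
      _ = ENNReal.ofReal (D ^ ρ) * ∫⁻ t in Set.Icc (-L) L,
          (∏ j, ‖gaussWeylPoly R M (θ j / 2 * t)‖ₑ) ^ ρ :=
          lintegral_const_mul' _ _ ENNReal.ofReal_ne_top
      _ ≤ ENNReal.ofReal (D ^ ρ) * (ENNReal.ofReal (2 * C) * ENNReal.ofReal (c * Φ)) := by
          gcongr
          refine lintegral_prod_rpow_le hd hρ0.le (fun j => hgm.comp (measurable_const_mul _)) fun j => ?_
          refine (setLIntegral_comp_mul_left_le (hgm.pow_const _) hC (hθ j).1 (hθ j).2).trans ?_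
          gcongr
      _ = _ := by
          rw [← ENNReal.ofReal_mul (by positivity), ← ENNReal.ofReal_mul (by positivity)]
  calc _ ≤ ENNReal.ofReal (∑ k ∈ S, ‖α k‖ ^ 2) *
        (ENNReal.ofReal (D ^ ρ * (2 * C * (c * Φ)))) ^ (1 / ρ) := by gcongr
    _ = _ := by
        rw [ENNReal.ofReal_rpow_of_nonneg (by positivity) (by positivity),
          ← ENNReal.ofReal_mul (Finset.sum_nonneg fun _ _ => by positivity),
          show D ^ ρ * (2 * C * (c * Φ)) = D ^ ρ * ((2 * C * c) * Φ) by ring,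
          Real.mul_rpow (by positivity) (by positivity), ← Real.rpow_mul hD0.le,
          mul_one_div_cancel hρ0.ne', Real.rpow_one, Real.mul_rpow (by positivity) hΦ0]
        congr 1
        ring

/-! ### Squaring trigonometric polynomials on the torus -/

lemma isProbabilityMeasure_volume_unitAddCircle :
    IsProbabilityMeasure (volume : Measure UnitAddCircle) :=
  inferInstanceAs (IsProbabilityMeasure AddCircle.haarAddCircle)

attribute [local instance] isProbabilityMeasure_volume_unitAddCircle

lemma sum_smul_mFourierLp {d : ℕ} (B : Finset (Fin d → ℤ)) (b : (Fin d → ℤ) → ℂ) :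
    (∑ n ∈ B, b n • mFourierLp 2 n : L2Torus d) =
      ContinuousMap.toLp (E := ℂ) 2 volume ℂ (∑ n ∈ B, b n • mFourier n) := by
  rw [map_sum]
  exact Finset.sum_congr rfl fun n _ => (map_smul _ _ _).symm

lemma normSq_sum_smul_mFourierLp {d : ℕ} (B : Finset (Fin d → ℤ)) (b : (Fin d → ℤ) → ℂ) :
    ‖(∑ n ∈ B, b n • mFourierLp 2 n : L2Torus d)‖ ^ 2 = ∑ n ∈ B, ‖b n‖ ^ 2 := by
  have h := orthonormal_mFourier (d := Fin d).inner_sum b b B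
  rw [inner_self_eq_norm_sq_to_K] at h
  have h2 : ∀ n, starRingEnd ℂ (b n) * b n = ((‖b n‖ ^ 2 : ℝ) : ℂ) := fun n => by
    rw [mul_comm, Complex.mul_conj, Complex.normSq_eq_norm_sq]
  simp_rw [h2] at h
  rw [← Complex.ofReal_sum, ← RCLike.ofReal_pow] at h
  exact Complex.ofReal_injective h

/-- The pairs of frequencies in `B` with sum `m`. -/
def pairFiber {d : ℕ} (B : Finset (Fin d → ℤ)) (m : Fin d → ℤ) :
    Finset ((Fin d → ℤ) × (Fin d → ℤ)) :=
  (B ×ˢ B).filter fun p => p.1 + p.2 = m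

/-- The sums of two frequencies in `B`. -/
def pairSums {d : ℕ} (B : Finset (Fin d → ℤ)) : Finset (Fin d → ℤ) :=
  (B ×ˢ B).image fun p => p.1 + p.2

lemma sum_pairSums_pairFiber {d : ℕ} {M : Type*} [AddCommMonoid M] (B : Finset (Fin d → ℤ))
    (F : (Fin d → ℤ) × (Fin d → ℤ) → M) :
    ∑ m ∈ pairSums B, ∑ p ∈ pairFiber B m, F p = ∑ p ∈ B ×ˢ B, F p :=
  Finset.sum_fiberwise_of_maps_to (fun _ hp => Finset.mem_image_of_mem _ hp) F

/-- The `L⁴` norm of a trigonometric polynomial through the Fourier coefficients of its square. -/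
lemma eLpNorm_four_sum_smul_mFourierLp {d : ℕ} (B : Finset (Fin d → ℤ)) (b : (Fin d → ℤ) → ℂ) :
    eLpNorm (∑ n ∈ B, b n • mFourierLp 2 n : L2Torus d) 4 volume ^ 4 =
      ∑ m ∈ pairSums B, ‖∑ p ∈ pairFiber B m, b p.1 * b p.2‖ₑ ^ 2 := by
  set U : C(UnitAddTorus (Fin d), ℂ) := ∑ n ∈ B, b n • mFourier n with hU
  set G : (Fin d → ℤ) → ℂ := fun m => ∑ p ∈ pairFiber B m, b p.1 * b p.2 with hG
  have hUU : U * U = ∑ m ∈ pairSums B, G m • mFourier m := by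
    rw [hU, Finset.sum_mul_sum, ← Finset.sum_product', ← sum_pairSums_pairFiber]
    refine Finset.sum_congr rfl fun m _ => ?_
    ext x
    simp only [hG, ContinuousMap.sum_apply, ContinuousMap.smul_apply, ContinuousMap.mul_apply,
      smul_eq_mul, Finset.sum_mul]
    refine Finset.sum_congr rfl fun p hp => ?_
    rw [← (Finset.mem_filter.mp hp).2, mFourier_add]
    ring
  have h1 : eLpNorm (∑ n ∈ B, b n • mFourierLp 2 n : L2Torus d) 4 volume =
      eLpNorm U 4 volume := by
    rw [sum_smul_mFourierLp]
    exact eLpNorm_congr_ae (ContinuousMap.coeFn_toLp volume U)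
  have h2 : eLpNorm U 4 volume ^ 2 = eLpNorm (U * U : C(UnitAddTorus (Fin d), ℂ)) 2 volume := by
    have h3 := eLpNorm_norm_rpow (p := 2) (μ := volume) (U : UnitAddTorus (Fin d) → ℂ)
      (q := 2) two_pos
    rw [show (2 : ℝ≥0∞) * ENNReal.ofReal 2 = 4 by rw [ENNReal.ofReal_ofNat]; norm_num,
      ENNReal.rpow_two] at h3
    rw [← h3]
    refine eLpNorm_congr_norm_ae (Filter.Eventually.of_forall fun x => ?_)
    simp [sq]
  have h4 : eLpNorm (U * U : C(UnitAddTorus (Fin d), ℂ)) 2 volume =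
      ‖(∑ m ∈ pairSums B, G m • mFourierLp 2 m : L2Torus d)‖ₑ := by
    rw [sum_smul_mFourierLp, ← hUU, Lp.enorm_def]
    exact (eLpNorm_congr_ae (ContinuousMap.coeFn_toLp volume (U * U))).symm
  rw [h1, show (4 : ℕ) = 2 * 2 by norm_num, pow_mul, h2, h4, ← ofReal_norm,
    ← ENNReal.ofReal_pow (norm_nonneg _), normSq_sum_smul_mFourierLp,
    ENNReal.ofReal_sum_of_nonneg fun _ _ => by positivity]
  refine Finset.sum_congr rfl fun m _ => ?_
  rw [ENNReal.ofReal_pow (norm_nonneg _), ofReal_norm]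

lemma sum_pairSums_normSq_mul {d : ℕ} (B : Finset (Fin d → ℤ)) (a : (Fin d → ℤ) → ℂ) :
    ∑ m ∈ pairSums B, ∑ p ∈ pairFiber B m, ‖a p.1 * a p.2‖ ^ 2 = (∑ n ∈ B, ‖a n‖ ^ 2) ^ 2 := by
  rw [sum_pairSums_pairFiber B fun p => ‖a p.1 * a p.2‖ ^ 2, sq, Finset.sum_mul_sum,
    ← Finset.sum_product']
  exact Finset.sum_congr rfl fun p _ => by rw [norm_mul, mul_pow]

/-- The box of lattice points `|n_j| ≤ N`. -/
noncomputable def latticeBox (d : ℕ) (N : ℝ) : Finset (Fin d → ℤ) :=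
  Fintype.piFinset fun _ => Finset.Icc (-⌊N⌋) ⌊N⌋

lemma mem_latticeBox {d : ℕ} {N : ℝ} {n : Fin d → ℤ} :
    n ∈ latticeBox d N ↔ ∀ j, |(n j : ℝ)| ≤ N := by
  rw [latticeBox, Fintype.mem_piFinset]
  refine forall_congr' fun j => ?_
  rw [Finset.mem_Icc, ← abs_le, Int.le_floor, Int.cast_abs]

lemma card_latticeBox_le (d : ℕ) {N : ℝ} (hN : 1 ≤ N) : ((latticeBox d N).card : ℝ) ≤ (3 * N) ^ d := by
  rw [latticeBox, Fintype.card_piFinset, Finset.prod_const, Finset.card_univ, Fintype.card_fin,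
    Nat.cast_pow]
  have h1 : 1 ≤ ⌊N⌋ := Int.le_floor.mpr (by exact_mod_cast hN)
  have h2 := Int.floor_le N
  gcongr
  rw [Int.card_Icc]
  have h3 : (((⌊N⌋ + 1 - -⌊N⌋).toNat : ℤ) : ℝ) = 2 * ⌊N⌋ + 1 := by
    rw [Int.toNat_of_nonneg (by omega)]
    push_cast
    ring
  have h4 : (1 : ℝ) ≤ ⌊N⌋ := by exact_mod_cast h1
  rw [Int.cast_natCast] at h3
  rw [h3]
  linarith

lemma FourierSupportedIn.mFourierCoeff_eq_zero {d : ℕ} {f : L2Torus d} {N : ℝ}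
    (hf : FourierSupportedIn f N) {n : Fin d → ℤ} (hn : n ∉ latticeBox d N) :
    mFourierCoeff f n = 0 := by
  by_contra h
  exact hn (mem_latticeBox.mpr (hf n h))

lemma FourierSupportedIn.schrodinger_eq {d : ℕ} {f : L2Torus d} {N : ℝ}
    (hf : FourierSupportedIn f N) (θ : Fin d → ℝ) (t : ℝ) :
    schrodinger θ t f = ∑ n ∈ latticeBox d N,
      (mFourierCoeff f n * Complex.exp (2 * Real.pi * Complex.I * (quadForm θ n * t : ℝ))) •
        mFourierLp 2 n :=
  tsum_eq_sum fun n hn => by rw [hf.mFourierCoeff_eq_zero hn, zero_mul, zero_smul]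

lemma FourierSupportedIn.sum_normSq {d : ℕ} {f : L2Torus d} {N : ℝ}
    (hf : FourierSupportedIn f N) :
    ∑ n ∈ latticeBox d N, ‖mFourierCoeff f n‖ ^ 2 = ‖f‖ ^ 2 := by
  rw [← normSq_sum_smul_mFourierLp]
  congr 2
  exact (hasSum_sum_of_ne_finset_zero fun n hn => by
    rw [hf.mFourierCoeff_eq_zero hn, zero_smul]).unique (hasSum_mFourier_series_L2 f)

/-- The Fourier coefficient of `(e^{-itΔ} f)²` at `m`, up to a unimodular factor: an exponential
sum with frequencies `Q(k) / 2`, where `k` is the difference of two frequencies with sum `m`. -/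
lemma norm_sum_pairFiber_eq {d : ℕ} (B : Finset (Fin d → ℤ)) (a : (Fin d → ℤ) → ℂ)
    (θ : Fin d → ℝ) (m : Fin d → ℤ) : ∃ (S : Finset (Fin d → ℤ)) (α : (Fin d → ℤ) → ℂ),
      (∀ k ∈ S, ∃ n ∈ B, ∃ n' ∈ B, k = n - n') ∧ S.card ≤ B.card ∧
      ∑ k ∈ S, ‖α k‖ ^ 2 = ∑ p ∈ pairFiber B m, ‖a p.1 * a p.2‖ ^ 2 ∧
      ∀ t : ℝ, ‖∑ p ∈ pairFiber B m,
        a p.1 * Complex.exp (2 * Real.pi * Complex.I * (quadForm θ p.1 * t : ℝ)) *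
        (a p.2 * Complex.exp (2 * Real.pi * Complex.I * (quadForm θ p.2 * t : ℝ)))‖ =
        ‖expSum S (fun k => quadForm θ k / 2) α t‖ := by
  classical
  -- Recovers the pair from its difference. The integer divisions are exact when k is a difference
  -- of a pair in the fiber; other values are never used.
  set α : (Fin d → ℤ) → ℂ := fun k =>
    a (fun j => (m j + k j) / 2) * a (fun j => (m j - k j) / 2) with hα
  have hm : ∀ p ∈ pairFiber B m, p.1 + p.2 = m := fun p hp => (Finset.mem_filter.mp hp).2
  have hαp : ∀ p ∈ pairFiber B m, α (p.1 - p.2) = a p.1 * a p.2 := fun p hp => by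
    have h := hm p hp
    rw [hα]
    simp only
    congr 2
    · funext j
      rw [← h]
      simp only [Pi.add_apply, Pi.sub_apply]
      omega
    · funext j
      rw [← h]
      simp only [Pi.add_apply, Pi.sub_apply]
      omega
  have hinj : Set.InjOn (fun p : (Fin d → ℤ) × (Fin d → ℤ) => p.1 - p.2) (pairFiber B m) := by
    intro p hp p' hp' h
    have h1 := hm p hp
    have h2 := hm p' hp'
    have key : ∀ j, p.1 j = p'.1 j ∧ p.2 j = p'.2 j := fun j => by
      have e1 := congrFun (h1.trans h2.symm) j
      have e2 := congrFun h j
      simp only [Pi.add_apply, Pi.sub_apply] at e1 e2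
      omega
    exact Prod.ext (funext fun j => (key j).1) (funext fun j => (key j).2)
  refine ⟨(pairFiber B m).image fun p => p.1 - p.2, α, fun k hk => ?_, ?_, ?_, fun t => ?_⟩
  · obtain ⟨p, hp, rfl⟩ := Finset.mem_image.mp hk
    have h := Finset.mem_product.mp (Finset.mem_filter.mp hp).1
    exact ⟨p.1, h.1, p.2, h.2, rfl⟩
  · refine Finset.card_image_le.trans (Finset.card_le_card_of_injOn Prod.fst (fun p hp =>
      (Finset.mem_product.mp (Finset.mem_filter.mp hp).1).1) fun p hp p' hp' h => ?_)
    exact Prod.ext h (add_left_cancel (((hm p hp).trans (hm p' hp').symm).trans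
      (congrArg (· + p'.2) h.symm)))
  · rw [Finset.sum_image hinj]
    exact Finset.sum_congr rfl fun p hp => by rw [hαp p hp]
  · have h : ∑ p ∈ pairFiber B m,
        a p.1 * Complex.exp (2 * Real.pi * Complex.I * (quadForm θ p.1 * t : ℝ)) *
        (a p.2 * Complex.exp (2 * Real.pi * Complex.I * (quadForm θ p.2 * t : ℝ))) =
        Complex.exp (2 * Real.pi * Complex.I * (quadForm θ m / 2 * t : ℝ)) *
        expSum ((pairFiber B m).image fun p => p.1 - p.2) (fun k => quadForm θ k / 2) α t := by
      rw [expSum, Finset.sum_image hinj, Finset.mul_sum]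
      refine Finset.sum_congr rfl fun p hp => ?_
      have hQ : quadForm θ p.1 + quadForm θ p.2 = quadForm θ m / 2 + quadForm θ (p.1 - p.2) / 2 := by
        rw [← hm p hp]
        simp only [quadForm]
        rw [← Finset.sum_add_distrib, Finset.sum_div, Finset.sum_div, ← Finset.sum_add_distrib]
        refine Finset.sum_congr rfl fun j _ => ?_
        simp only [Pi.add_apply, Pi.sub_apply]
        push_cast
        ring
      rw [hαp p hp, mul_mul_mul_comm, ← Complex.exp_add, mul_left_comm, ← Complex.exp_add]
      congr 2
      rw [← mul_add, ← mul_add, ← Complex.ofReal_add, ← Complex.ofReal_add, ← add_mul, ← add_mul,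
        hQ]
    rw [h, norm_mul, norm_exp_two_pi_mul, one_mul]

/-- The fourth power of the spatial norm is a finite sum of squares of exponential sums. -/
lemma FourierSupportedIn.eLpNorm_schrodinger_pow {d : ℕ} {f : L2Torus d} {N : ℝ}
    (hf : FourierSupportedIn f N) (θ : Fin d → ℝ) :
    ∃ (T : Finset (Fin d → ℤ)) (S : (Fin d → ℤ) → Finset (Fin d → ℤ))
      (α : (Fin d → ℤ) → (Fin d → ℤ) → ℂ),
      (∀ m, ∀ k ∈ S m, ∀ j, |(k j : ℝ)| ≤ 2 * N) ∧
      (∀ m, (S m).card ≤ (latticeBox d N).card) ∧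
      ∑ m ∈ T, ∑ k ∈ S m, ‖α m k‖ ^ 2 = ‖f‖ ^ 4 ∧
      ∀ t, eLpNorm (schrodinger θ t f) 4 volume ^ 4 =
        ∑ m ∈ T, ‖expSum (S m) (fun k => quadForm θ k / 2) (α m) t‖ₑ ^ 2 := by
  choose S α hS1 hS2 hS3 hS4 using
    norm_sum_pairFiber_eq (latticeBox d N) (fun n => mFourierCoeff f n) θ
  refine ⟨pairSums (latticeBox d N), S, α, fun m k hk j => ?_, hS2, ?_, fun t => ?_⟩
  · obtain ⟨n, hn, n', hn', rfl⟩ := hS1 m k hk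
    have h1 := mem_latticeBox.mp hn j
    have h2 := mem_latticeBox.mp hn' j
    rw [Pi.sub_apply, Int.cast_sub]
    exact (abs_sub _ _).trans (by linarith)
  · simp_rw [hS3]
    rw [sum_pairSums_normSq_mul, hf.sum_normSq]
    ring
  · rw [hf.schrodinger_eq θ t, eLpNorm_four_sum_smul_mFourierLp]
    refine Finset.sum_congr rfl fun m _ => ?_
    rw [← ofReal_norm, ← ofReal_norm, hS4 m t]

/-! ### Strichartz estimates -/

/-- The Strichartz estimate for finite `p`, with the constant expressed through the mean value of
quadratic Weyl sums. -/
theorem exists_evolutionNorm_le {d : ℕ} (hd : 0 < d) {p : ℝ≥0∞} (hp : 4 ≤ p) (hpt : p ≠ ⊤) {ρ : ℝ}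
    (hρp : p.toReal = 4 * ρ) (hs : 4 ≤ d * ρ) {C L : ℝ} (hC : 1 ≤ C) (hL : 0 < L) :
    ∃ c : ℝ, 0 < c ∧ ∀ θ : Fin d → ℝ, (∀ j, 1 / C ≤ θ j ∧ θ j ≤ C) → ∀ a b : ℝ, b - a = L →
      ∀ N : ℝ, 1 ≤ N → ∀ f : L2Torus d, FourierSupportedIn f N →
      evolutionNorm θ p (Set.Icc a b) f ≤ ENNReal.ofReal (c *
        ((2 * N) ^ (d * ρ - 2) * ∑ q ∈ Finset.Icc 1 ⌊2 * N⌋₊, (q : ℝ) ^ (1 - d * ρ / 2)) ^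
          (1 / (4 * ρ)) * ‖f‖) := by
  have hρ : 1 ≤ ρ := by
    have := (ENNReal.toReal_le_toReal (by norm_num) hpt).mpr hp
    rw [hρp] at this
    norm_num at this
    exact this
  have hρ0 : 0 < ρ := by linarith
  obtain ⟨c, hc, hW⟩ := exists_lintegral_quadForm_expSum_le hd hρ hs hC hL
  refine ⟨c ^ (1 / 4 : ℝ), by positivity, fun θ hθ a b hab N hN f hf => ?_⟩
  obtain ⟨T, S, α, hS, -, hα, hu⟩ := hf.eLpNorm_schrodinger_pow θ
  set Φ := (2 * N) ^ (d * ρ - 2) * ∑ q ∈ Finset.Icc 1 ⌊2 * N⌋₊, (q : ℝ) ^ (1 - d * ρ / 2) with hΦ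
  have hΦ0 : 0 ≤ Φ := by positivity
  set μ := volume.restrict (Set.Icc a b) with hμ
  set Y : (Fin d → ℤ) → ℝ → ℝ≥0∞ := fun m t =>
    ‖expSum (S m) (fun k => quadForm θ k / 2) (α m) t‖ₑ ^ 2 with hY
  have hYm : ∀ m, Measurable (Y m) := fun m =>
    ((continuous_expSum (S m) (fun k => quadForm θ k / 2) (α m)).measurable.enorm).pow_const 2
  have hYi : ∀ m, eLpNorm (Y m) (ENNReal.ofReal ρ) μ ≤
      ENNReal.ofReal (c * Φ ^ (1 / ρ) * ∑ k ∈ S m, ‖α m k‖ ^ 2) := fun m => by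
    rw [eLpNorm_eq_lintegral_rpow_enorm_toReal (ENNReal.ofReal_pos.mpr hρ0).ne'
      ENNReal.ofReal_ne_top, ENNReal.toReal_ofReal hρ0.le]
    refine le_trans (le_of_eq ?_) (hW θ hθ a b hab (2 * N) (by linarith) (S m) (α m) (hS m))
    congr 1
    refine lintegral_congr fun t => ?_
    rw [enorm_eq_self, hY, ENNReal.rpow_mul, ENNReal.rpow_two]
  -- Minkowski in L^ρ, which needs ρ ≥ 1, that is p ≥ 4.
  have hmink : eLpNorm (∑ m ∈ T, Y m) (ENNReal.ofReal ρ) μ ≤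
      ENNReal.ofReal (c * Φ ^ (1 / ρ) * ‖f‖ ^ 4) := by
    refine (eLpNorm_sum_le (fun m _ => (hYm m).aestronglyMeasurable)
      (by rw [← ENNReal.ofReal_one]; exact ENNReal.ofReal_le_ofReal hρ)).trans ?_
    refine (Finset.sum_le_sum fun m _ => hYi m).trans (le_of_eq ?_)
    rw [← ENNReal.ofReal_sum_of_nonneg fun m _ => by positivity, ← Finset.mul_sum, hα]
  have hevo : evolutionNorm θ p (Set.Icc a b) f =
      eLpNorm (∑ m ∈ T, Y m) (ENNReal.ofReal ρ) μ ^ (1 / 4 : ℝ) := by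
    rw [evolutionNorm, eLpNorm_eq_lintegral_rpow_enorm_toReal (by rintro rfl; simp at hp) hpt,
      eLpNorm_eq_lintegral_rpow_enorm_toReal (ENNReal.ofReal_pos.mpr hρ0).ne'
      ENNReal.ofReal_ne_top, ENNReal.toReal_ofReal hρ0.le, hρp, ← ENNReal.rpow_mul]
    congr 1
    · refine lintegral_congr fun t => ?_
      rw [enorm_eq_self, enorm_eq_self, ENNReal.rpow_mul, Finset.sum_apply]
      congr 1
      rw [← hu t, ← ENNReal.rpow_natCast]
      norm_num
    · field_simp
  rw [hevo]
  refine (ENNReal.rpow_le_rpow hmink (by norm_num)).trans (le_of_eq ?_)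
  rw [ENNReal.ofReal_rpow_of_nonneg (by positivity) (by norm_num)]
  congr 1
  rw [Real.mul_rpow (by positivity) (by positivity), Real.mul_rpow hc.le (by positivity),
    ← Real.rpow_mul hΦ0, ← Real.rpow_natCast ‖f‖ 4, ← Real.rpow_mul (norm_nonneg f)]
  norm_num

/-- Cauchy–Schwarz on each coefficient of the square, which has at most (3N)^d terms, followed by a
fourth root. -/
theorem evolutionNorm_top_le {d : ℕ} (θ : Fin d → ℝ) (I : Set ℝ) {N : ℝ} (hN : 1 ≤ N)
    {f : L2Torus d} (hf : FourierSupportedIn f N) :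
    evolutionNorm θ ⊤ I f ≤ ENNReal.ofReal (3 ^ ((d : ℝ) / 4) * N ^ ((d : ℝ) / 4) * ‖f‖) := by
  obtain ⟨T, S, α, -, hcard, hα, hu⟩ := hf.eLpNorm_schrodinger_pow θ
  rw [evolutionNorm, eLpNorm_exponent_top, eLpNormEssSup]
  refine essSup_le_of_ae_le _ (Filter.Eventually.of_forall fun t => ?_)
  simp only [enorm_eq_self]
  rw [← ENNReal.pow_le_pow_left_iff (show (4 : ℕ) ≠ 0 by norm_num), hu t]
  calc _ ≤ ∑ m ∈ T, ENNReal.ofReal ((3 * N) ^ d * ∑ k ∈ S m, ‖α m k‖ ^ 2) := by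
        refine Finset.sum_le_sum fun m _ => ?_
        rw [← ofReal_norm, ← ENNReal.ofReal_pow (norm_nonneg _)]
        apply ENNReal.ofReal_le_ofReal
        have h1 : ‖expSum (S m) (fun k => quadForm θ k / 2) (α m) t‖ ≤ ∑ k ∈ S m, ‖α m k‖ :=
          (norm_sum_le _ _).trans (le_of_eq (Finset.sum_congr rfl fun k _ => by
            rw [norm_mul, norm_exp_two_pi_mul, mul_one]))
        have h2 : ((S m).card : ℝ) ≤ (3 * N) ^ d :=
          (Nat.cast_le.mpr (hcard m)).trans (card_latticeBox_le d hN)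
        calc _ ≤ (∑ k ∈ S m, ‖α m k‖) ^ 2 := by gcongr
          _ ≤ (S m).card * ∑ k ∈ S m, ‖α m k‖ ^ 2 := sq_sum_le_card_mul_sum_sq
          _ ≤ _ := by gcongr
    _ = ENNReal.ofReal ((3 * N) ^ d * ‖f‖ ^ 4) := by
        rw [← ENNReal.ofReal_sum_of_nonneg fun m _ => by positivity, ← Finset.mul_sum, hα]
    _ = _ := by
        rw [← ENNReal.ofReal_pow (by positivity), ← Real.mul_rpow (by norm_num) (by positivity),
          mul_pow _ ‖f‖, ← Real.rpow_natCast ((3 * N) ^ ((d : ℝ) / 4)) 4,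
          ← Real.rpow_mul (by positivity), ← Real.rpow_natCast (3 * N) d]
        congr 3
        push_cast
        ring

lemma StrichartzL4.mono {d : ℕ} {p : ℝ≥0∞} {N₀ N₁ : ℝ} {κ κ' : ℝ → ℝ} (h : StrichartzL4 d p N₀ κ)
    (hN : N₀ ≤ N₁) {A : ℝ} (hA : 0 < A) (hκ : ∀ N, N₁ ≤ N → κ N ≤ A * κ' N) :
    StrichartzL4 d p N₁ κ' := by
  intro C hC L hL
  obtain ⟨K, hK, H⟩ := h C hC L hL
  refine ⟨K * A, by positivity, fun θ hθ a b hab N hNN f hf =>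
    (H θ hθ a b hab N (hN.trans hNN) f hf).trans (ENNReal.ofReal_le_ofReal ?_)⟩
  rw [mul_assoc K A]
  exact mul_le_mul_of_nonneg_right (mul_le_mul_of_nonneg_left (hκ N hNN) hK.le) (norm_nonneg f)

theorem strichartzL4_of_lt {d : ℕ} (hd : 0 < d) {p : ℝ≥0∞} (hp : 4 ≤ p)
    (hdp : 16 / (d : ℝ≥0∞) < p) :
    StrichartzL4 d p 1 (fun N => N ^ ((d : ℝ) / 4 - (2 / p).toReal)) := by
  intro C hC L hL
  have hd0 : (0 : ℝ) < d := by exact_mod_cast hd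
  rcases eq_or_ne p ⊤ with rfl | hpt
  · refine ⟨3 ^ ((d : ℝ) / 4), by positivity, fun θ hθ a b hab N hN f hf => ?_⟩
    simpa using evolutionNorm_top_le θ (Set.Icc a b) hN hf
  · set ρ := p.toReal / 4 with hρ
    have hρp : p.toReal = 4 * ρ := by rw [hρ]; ring
    have hlt : 16 / (d : ℝ) < p.toReal := by
      have := (ENNReal.toReal_lt_toReal (ne_top_of_lt hdp) hpt).mpr hdp
      simpa using this
    have hs : 4 < d * ρ := by
      rw [div_lt_iff₀ hd0, hρp] at hlt
      linarith
    have hρ0 : 0 < ρ := by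
      by_contra! h
      nlinarith
    obtain ⟨c, hc, H⟩ := exists_evolutionNorm_le hd hp hpt hρp hs.le hC hL
    obtain ⟨c', hc', H'⟩ := exists_sum_Icc_rpow_le hs
    refine ⟨c * (2 ^ (d * ρ - 2) * c') ^ (1 / (4 * ρ)), by positivity,
      fun θ hθ a b hab N hN f hf => (H θ hθ a b hab N hN f hf).trans
        (ENNReal.ofReal_le_ofReal ?_)⟩
    have hN0 : 0 < N := by linarith
    have e : N ^ ((d : ℝ) / 4 - (2 / p).toReal) = (N ^ (d * ρ - 2)) ^ (1 / (4 * ρ)) := by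
      rw [← Real.rpow_mul hN0.le, ENNReal.toReal_div, hρp]
      congr 1
      simp only [ENNReal.toReal_ofNat]
      field_simp
    beta_reduce
    rw [e, mul_assoc c ((2 ^ (d * ρ - 2) * c') ^ (1 / (4 * ρ))),
      ← Real.mul_rpow (by positivity) (by positivity)]
    refine mul_le_mul_of_nonneg_right (mul_le_mul_of_nonneg_left
      (Real.rpow_le_rpow (by positivity) ?_ (by positivity)) hc.le) (norm_nonneg f)
    rw [Real.mul_rpow two_pos.le hN0.le]
    calc _ ≤ 2 ^ (d * ρ - 2) * N ^ (d * ρ - 2) * c' := by gcongr; exact H' _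
      _ = _ := by ring

/-- At s = 4 the sum over q is harmonic and gives log N to the power 1/p. -/
theorem strichartzL4_of_eq {d : ℕ} (hd : 0 < d) {p : ℝ≥0∞} (hp : 4 ≤ p) (hpt : p ≠ ⊤)
    (hdp : d * p.toReal = 16) :
    StrichartzL4 d p 2
      (fun N => N ^ ((d : ℝ) / 4 - (2 / p).toReal) * Real.log N ^ (2 / p).toReal) := by
  intro C hC L hL
  set ρ := p.toReal / 4 with hρ
  have hρp : p.toReal = 4 * ρ := by rw [hρ]; ring
  have hs : d * ρ = 4 := by
    rw [hρp] at hdp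
    linarith
  have hρ0 : 0 < ρ := by
    by_contra! h
    have : (0 : ℝ) ≤ d := Nat.cast_nonneg d
    nlinarith
  obtain ⟨c, hc, H⟩ := exists_evolutionNorm_le hd hp hpt hρp hs.ge hC hL
  have hlog2 : 0 < Real.log 2 := Real.log_pos (by norm_num)
  refine ⟨c * (16 / Real.log 2) ^ (1 / (4 * ρ)), by positivity,
    fun θ hθ a b hab N hN f hf => (H θ hθ a b hab N (by linarith) f hf).trans
      (ENNReal.ofReal_le_ofReal ?_)⟩
  have hN0 : 0 < N := by linarith
  have hlogN : Real.log 2 ≤ Real.log N := Real.log_le_log two_pos hN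
  have hlogN0 : 0 < Real.log N := by linarith
  have e : N ^ ((d : ℝ) / 4 - (2 / p).toReal) = (N ^ (2 : ℕ)) ^ (1 / (4 * ρ)) := by
    rw [← Real.rpow_natCast N 2, ← Real.rpow_mul hN0.le, ENNReal.toReal_div, hρp]
    congr 1
    simp only [ENNReal.toReal_ofNat]
    push_cast
    field_simp
    linarith
  have e2 : Real.log N ^ (2 / p).toReal = (Real.log N ^ (2 : ℕ)) ^ (1 / (4 * ρ)) := by
    rw [← Real.rpow_natCast (Real.log N) 2, ← Real.rpow_mul hlogN0.le, ENNReal.toReal_div, hρp]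
    congr 1
    simp only [ENNReal.toReal_ofNat]
    push_cast
    ring
  beta_reduce
  rw [e, e2, mul_assoc c ((16 / Real.log 2) ^ (1 / (4 * ρ))),
    ← Real.mul_rpow (by positivity) (by positivity),
    ← Real.mul_rpow (by positivity) (by positivity)]
  refine mul_le_mul_of_nonneg_right (mul_le_mul_of_nonneg_left
      (Real.rpow_le_rpow (by positivity) ?_ (by positivity)) hc.le) (norm_nonneg f)
  rw [hs]
  have h1 : ∑ q ∈ Finset.Icc 1 ⌊2 * N⌋₊, (q : ℝ) ^ (1 - (4 : ℝ) / 2) ≤ 4 * Real.log N := by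
    refine (sum_Icc_rpow_le_one_add_log (by linarith)).trans ?_
    rw [Real.log_mul two_ne_zero hN0.ne']
    have := Real.log_two_gt_d9
    linarith
  -- Since log N ≥ log 2, the exponent 1/p of the logarithm may be relaxed to the stated 2/p.
  have h2 : Real.log N ≤ Real.log N ^ 2 / Real.log 2 := by
    rw [le_div_iff₀ hlog2, sq]
    gcongr
  calc (2 * N) ^ ((4 : ℝ) - 2) * _ ≤ (2 * N) ^ ((4 : ℝ) - 2) * (4 * Real.log N) := by gcongr
    _ = 16 * N ^ 2 * Real.log N := by
        rw [show (4 : ℝ) - 2 = 2 by norm_num, Real.rpow_two]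
        ring
    _ ≤ 16 * N ^ 2 * (Real.log N ^ 2 / Real.log 2) := by gcongr
    _ = _ := by ring

theorem mainTheorem6 :
    (∀ (d : ℕ) (p : ℝ≥0∞), 3 ≤ d → 4 ≤ p → 16 / (d : ℝ≥0∞) < p →
      StrichartzL4 d p 1 (fun N => N ^ ((d : ℝ) / 4 - (2 / p).toReal))) ∧
    (∀ (d : ℕ) (p q : ℝ≥0∞),
      (d = 2 ∧ 8 ≤ p ∧ q = 8) ∨ (d = 3 ∧ p = 16 / 3 ∧ q = p) ∨ (d = 4 ∧ p = 4 ∧ q = p) →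
      StrichartzL4 d p 2
        (fun N => N ^ ((d : ℝ) / 4 - (2 / p).toReal) * Real.log N ^ (2 / q).toReal)) := by
  refine ⟨fun d p hd hp hdp => strichartzL4_of_lt (by omega) hp hdp, ?_⟩
  rintro d p q (⟨rfl, hp, rfl⟩ | ⟨rfl, rfl, rfl⟩ | ⟨rfl, rfl, rfl⟩)
  · rcases hp.eq_or_lt with rfl | hp8
    · exact strichartzL4_of_eq two_pos (by norm_num) (by norm_num) (by norm_num)
    · have h8 : 16 / ((2 : ℕ) : ℝ≥0∞) = 8 := by
        rw [eq_comm, ENNReal.eq_div_iff (by norm_num) (by norm_num)]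
        norm_num
      have hlog2 : 0 < Real.log 2 := Real.log_pos (by norm_num)
      -- For d = 2 and p > 8 there is no logarithmic loss; the stated factor is bounded below
      -- because N ≥ 2.
      refine (strichartzL4_of_lt two_pos (le_trans (by norm_num) hp) (h8 ▸ hp8)).mono
        one_le_two (A := (Real.log 2 ^ (2 / 8 : ℝ≥0∞).toReal)⁻¹) (by positivity) fun N hN => ?_
      have hlogN : Real.log 2 ≤ Real.log N := Real.log_le_log two_pos hN
      have h1 : Real.log 2 ^ (2 / 8 : ℝ≥0∞).toReal ≤ Real.log N ^ (2 / 8 : ℝ≥0∞).toReal := by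
        gcongr
      have hN0 : 0 ≤ N := by linarith
      rw [inv_mul_eq_div, le_div_iff₀ (by positivity)]
      gcongr
  · have h4 : (4 : ℝ≥0∞) ≤ 16 / 3 := by
      rw [ENNReal.le_div_iff_mul_le (by norm_num) (by norm_num)]
      norm_num
    refine strichartzL4_of_eq (by norm_num) h4 (ENNReal.div_ne_top (by norm_num) (by norm_num)) ?_
    rw [ENNReal.toReal_div]
    norm_num
  · exact strichartzL4_of_eq (by norm_num) le_rfl (by norm_num) (by norm_num)
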